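/- Let $p$ be a prime and $C_p$ the cyclic group of order $p$. **Definitions.** Let $G$ be a finite group, and let $\mathcal F$ be a $G$-family: a full subcategory of the orbit category $\mathcal O_G$ (finite nonempty transitive $G$-sets) containing $U$ whenever there is a map $U\to V$ with $V\in\mathcal F$. For $V\in\mathcal F$, a (finite) $V$-set is a finite $G$-set over $V$; for $V=G/H$ these are equivalent to finite $H$-sets. Write $*_V=(V=V)$ and $\emptyset_V=(\emptyset\to V)$. For a $V$-set $S$ and $U$-sets $T_U$, one for each orbit $U\in\mathrm{Orb}(S)$, the $S$-indexed coproduct is $\coprod_{U\in \mathrm{Orb}(S)}\mathrm{Ind}_U^V T_U$, where $\mathrm{Ind}_U^V$ is composition with $U\to S\to V$. An $\mathcal F$-weak indexing system $I$ is a choice, for each $V\in\mathcal F$, of a class $I_V$ of $V$-sets such that: - the classes $I_V$ are closed under isomorphism and under restriction (pullback) along maps in $\mathcal F$; - $*_V\in I_V$ whenever $I_V\ne\emptyset$; - $I$ is closed under self-indexed coproducts: if $S\in I_V$ and $T_U\in I_U$ for all $U\in\mathrm{Orb}(S)$, then the $S$-indexed coproduct of $(T_U)$ is in $I_V$. Weak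 indexing systems are ordered by inclusion and form a complete lattice, with join $\vee$. A $G$-weak indexing system is an $\mathcal O_G$-weak indexing system. Such an $I$ - is *almost essentially unital* if $S\sqcup S'\in I_V$ with $S\sqcup S'\not\cong *_V$ implies $S,S'\in I_V$; - is *almost unital* if moreover $I_V\neq\emptyset$ for all $V$; - is *unital* if $I_V\neq\emptyset$ for all $V$ and $S\sqcup S'\in I_V$ always implies $S,S'\in I_V$; - is an *indexing system* if each $I_V$ is closed under finite (including empty) coproducts. For an $\mathcal F$-weak indexing system $I$, let $E_{\mathcal F}^G I$ be the $G$-weak indexing system which agrees with $I$ on $\mathcal F$ and is empty elsewhere; write $E_e^{C_p}$ when $G=C_p$ and $\mathcal F=\{e\}$ is the family of free orbits. Let $\mathbb F^{\mathrm{triv}}$, $\mathbb F^0$, $\mathbb F^\infty$ be the weak indexing systems with $V$-values (up to isomorphism) $\{*_V\}$, $\{\emptyset_V,*_V\}$, $\{n\cdot *_V\mid n\in\mathbb N\}$, with subscript $C_p$ when taken over all orbits of $C_p$, and no subscript when taken over the family $\{e\}$. Let $\mathbb F_{C_p}$ consist of all finite $V$-sets, and put $$\mathbb F^0_e=\mathbb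 F^{\mathrm{triv}}_{C_p}\vee E_e^{C_p}\mathbb F^0,\qquad \mathbb F^\infty_e=\mathbb F^0_{C_p}\vee E_e^{C_p}\mathbb F^\infty .$$ Let $\overline{\mathbb F}_{C_p}$ be the join of $\mathbb F^0_{C_p}$ with the least weak indexing system containing all restrictions $\mathrm{Res}_V^W U$ of the $W$-sets $U\to W$ in the complete transfer system $\mathcal O_{C_p}$. Finally, let $\lambda$ be any nontrivial irreducible orthogonal real $C_p$-representation, and let $\mathbb F^\lambda$ be the weak indexing system whose value at $C_p/H$ consists of the finite $H$-sets admitting an $H$-equivariant embedding into $\lambda$. **Theorem.** The poset of almost essentially unital $C_p$-weak indexing systems consists of exactly the following 13 pairwise distinct elements, and the arrows are exactly its covering relations (so the order is their reflexive transitive closure): $$\emptyset\to E_e^{C_p}\mathbb F^{\mathrm{triv}},\quad E_e^{C_p}\mathbb F^{\mathrm{triv}}\to E_e^{C_p}\mathbb F^0,\quad E_e^{C_p}\mathbb F^{\mathrm{triv}}\to \mathbb F^{\mathrm{triv}}_{C_p},\quad E_e^{C_p}\mathbb F^0\to E_e^{C_p}\mathbb F^\infty,$$ $$E_e^{C_p}\mathbb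 F^0\to\mathbb F^0_e,\quad E_e^{C_p}\mathbb F^\infty\to \mathbb F^{\mathrm{triv}}_{C_p}\vee E_e^{C_p}\mathbb F^\infty,\quad \mathbb F^{\mathrm{triv}}_{C_p}\to\mathbb F^0_e,\quad \mathbb F^0_e\to \mathbb F^{\mathrm{triv}}_{C_p}\vee E_e^{C_p}\mathbb F^\infty,$$ $$\mathbb F^0_e\to\mathbb F^0_{C_p},\quad \mathbb F^{\mathrm{triv}}_{C_p}\vee E_e^{C_p}\mathbb F^\infty\to\mathbb F^\infty_e,\quad \mathbb F^0_{C_p}\to\mathbb F^\infty_e,\quad \mathbb F^\infty_e\to\mathbb F^\infty_{C_p},$$ $$\mathbb F^\infty_e\to\overline{\mathbb F}_{C_p},\quad \mathbb F^\infty_{C_p}\to\mathbb F_{C_p},\quad \overline{\mathbb F}_{C_p}\to\mathbb F^\lambda,\quad \mathbb F^\lambda\to\mathbb F_{C_p}.$$ Moreover, the indexing systems are exactly $\mathbb F^\infty_{C_p}$ and $\mathbb F_{C_p}$; the unital $C_p$-weak indexing systems that are not indexing systems are exactly $\mathbb F^0_{C_p},\mathbb F^\infty_e,\overline{\mathbb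 F}_{C_p},\mathbb F^\lambda$; and the almost unital ones that are not unital are exactly $\mathbb F^{\mathrm{triv}}_{C_p},\mathbb F^0_e,\mathbb F^{\mathrm{triv}}_{C_p}\vee E_e^{C_p}\mathbb F^\infty$. -/

import Mathlib

namespace WeakIndexing

/-! ### Finite `G`-sets, orbits and finite `V`-sets -/

/-- A finite `G`-set. -/
structure FinGSet (G : Type) [Group G] where
  carrier : Type
  [action : MulAction G carrier]
  [finite : Finite carrier]

instance {G : Type} [Group G] : CoeSort (FinGSet G) Type := ⟨FinGSet.carrier⟩

attribute [instance] FinGSet.action FinGSet.finite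

/-- An object of the orbit category of `G`: a finite nonempty transitive `G`-set. Morphisms are
all `G`-equivariant maps `U →[G] V`. -/
structure GOrbit (G : Type) [Group G] extends FinGSet G where
  [nonempty : Nonempty carrier]
  [transitive : MulAction.IsPretransitive G carrier]

instance {G : Type} [Group G] : CoeSort (GOrbit G) Type := ⟨fun V => V.carrier⟩

attribute [instance] GOrbit.nonempty GOrbit.transitive

/-- A finite `V`-set: an object of the slice of finite `G`-sets over the orbit `V`. For
`V = G/H` this category is equivalent to that of finite `H`-sets, by sending `S` to the fibre
of `S` over the base point. -/
structure VSet {G : Type} [Group G] (V : GOrbit G) where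
  total : FinGSet G
  proj : total →[G] V

section Operations

variable {G : Type} [Group G]

/-- Two `V`-sets are isomorphic (over `V`). -/
def VSet.Iso {V : GOrbit G} (S T : VSet V) : Prop :=
  ∃ e : S.total →[G] T.total, Function.Bijective e ∧ ∀ x, T.proj (e x) = S.proj x

/-- The terminal `V`-set `*_V = (V = V)`. -/
def VSet.point (V : GOrbit G) : VSet V where
  total := V.toFinGSet
  proj := MulActionHom.id G

/-- The empty `G`-set. -/
def FinGSet.empty (G : Type) [Group G] : FinGSet G where
  carrier := Empty
  action :=
    { smul := fun _ x => x
      one_smul := fun x => x.elim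
      mul_smul := fun _ _ x => x.elim }

/-- The empty `V`-set `∅_V`. -/
def VSet.empty (V : GOrbit G) : VSet V where
  total := FinGSet.empty G
  proj := { toFun := fun x => x.elim, map_smul' := fun _ x => x.elim }

/-- The coproduct `S ⊔ T` of two `V`-sets. -/
def VSet.sum {V : GOrbit G} (S T : VSet V) : VSet V where
  total := { carrier := S.total ⊕ T.total }
  proj :=
    { toFun := Sum.elim S.proj T.proj
      map_smul' := by
        rintro g (x | x)
        · exact map_smul S.proj g x
        · exact map_smul T.proj g x }

/-- The `V`-set `n · *_V`, the coproduct of `n` copies of `*_V`. -/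
def VSet.copies (n : ℕ) (V : GOrbit G) : VSet V where
  total := { carrier := Σ _ : Fin n, (V : Type) }
  proj := { toFun := fun x => x.2, map_smul' := fun _ _ => rfl }

/-- The `V`-set `Ind_U^V *_U` given by a map of orbits `U → V`. -/
def VSet.ofMap {U V : GOrbit G} (f : U →[G] V) : VSet V where
  total := U.toFinGSet
  proj := f

/-- The `G`-action on the fibre product of `U → V ← S`. -/
instance pullbackAction {U V : GOrbit G} (f : U →[G] V) (S : VSet V) :
    MulAction G {x : U × S.total // f x.1 = S.proj x.2} where
  smul g x := ⟨(g • x.1.1, g • x.1.2), by simp [map_smul, x.2]⟩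
  one_smul x := Subtype.ext (Prod.ext (one_smul G x.1.1) (one_smul G x.1.2))
  mul_smul g h x := Subtype.ext (Prod.ext (mul_smul g h x.1.1) (mul_smul g h x.1.2))

/-- Restriction `Res_U^V S` of a `V`-set along a map of orbits `U → V`: the pullback
`U ×_V S → U`. -/
def VSet.res {U V : GOrbit G} (f : U →[G] V) (S : VSet V) : VSet U where
  total := { carrier := {x : U × S.total // f x.1 = S.proj x.2} }
  proj := { toFun := fun x => x.1.1, map_smul' := fun _ _ => rfl }

/-- The set `Orb(S)` of orbits of a `V`-set `S`. -/
abbrev VSet.Orb {V : GOrbit G} (S : VSet V) : Type :=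
  MulAction.orbitRel.Quotient G S.total

/-- An orbit of a `V`-set, as an object of the orbit category. -/
def VSet.orbit {V : GOrbit G} (S : VSet V) (o : S.Orb) : GOrbit G where
  carrier := o.orbit
  nonempty := (MulAction.orbitRel.Quotient.nonempty_orbit o).to_subtype
  transitive := ⟨fun x y => by
    have hx := MulAction.orbitRel.Quotient.mem_orbit.1 x.2
    have hy := MulAction.orbitRel.Quotient.mem_orbit.1 y.2
    obtain ⟨g, hg⟩ := Quotient.exact (hy.trans hx.symm)
    exact ⟨g, Subtype.ext hg⟩⟩

/-- The composite `U → S → V` for an orbit `U` of a `V`-set `S`. -/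
def VSet.orbitMap {V : GOrbit G} (S : VSet V) (o : S.Orb) : S.orbit o →[G] V where
  toFun x := S.proj x.1
  map_smul' g x := map_smul S.proj g x.1

/-- Induction `Ind_U^V T` of a `U`-set along a map of orbits `U → V`: postcomposition. -/
def VSet.ind {U V : GOrbit G} (f : U →[G] V) (T : VSet U) : VSet V where
  total := T.total
  proj := f.comp T.proj

/-- The `S`-indexed coproduct `∐_{U ∈ Orb(S)} Ind_U^V T_U`. -/
def VSet.indexedCoprod {V : GOrbit G} (S : VSet V) (T : ∀ o : S.Orb, VSet (S.orbit o)) :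
    VSet V where
  total := { carrier := Σ o : S.Orb, ((T o).ind (S.orbitMap o)).total }
  proj :=
    { toFun := fun x => ((T x.1).ind (S.orbitMap x.1)).proj x.2
      map_smul' := fun g x => map_smul ((T x.1).ind (S.orbitMap x.1)).proj g x.2 }

end Operations

/-! ### Families and weak indexing systems -/

/-- A `G`-family, as a full subcategory of the orbit category that contains the source of
every map whose target it contains. -/
structure Family (G : Type) [Group G] where
  carrier : Set (GOrbit G)
  closed : ∀ {U V : GOrbit G}, (U →[G] V) → V ∈ carrier → U ∈ carrier

instance {G : Type} [Group G] : Membership (GOrbit G) (Family G) := ⟨fun F V => V ∈ F.carrier⟩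

/-- The family of all orbits. -/
def Family.all (G : Type) [Group G] : Family G where
  carrier := Set.univ
  closed _ _ := trivial

/-- The family `{e}` of free orbits, i.e. of those isomorphic to `G/e`. -/
def Family.free (G : Type) [Group G] : Family G where
  carrier := {V | ∀ (g : G) (x : V), g • x = x → g = 1}
  closed f hV g x h := hV g (f x) (by rw [← map_smul, h])

/-- An `F`-weak indexing system, for a `G`-family `F`: a full `F`-subcategory of the finite
`F`-sets (an isomorphism-closed and restriction-stable class of `V`-sets for `V` in `F`) that
contains `*_V` whenever its `V`-value is nonempty and is closed under self-indexed coproducts. -/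
@[ext]
structure WIndSys {G : Type} [Group G] (F : Family G) where
  sets : ∀ V : GOrbit G, V ∈ F → Set (VSet V)
  iso_mem : ∀ {V : GOrbit G} (hV : V ∈ F) {S T : VSet V},
    S.Iso T → S ∈ sets V hV → T ∈ sets V hV
  res_mem : ∀ {U V : GOrbit G} (hV : V ∈ F) (f : U →[G] V) {S : VSet V},
    S ∈ sets V hV → S.res f ∈ sets U (F.closed f hV)
  point_mem : ∀ {V : GOrbit G} (hV : V ∈ F), (sets V hV).Nonempty → VSet.point V ∈ sets V hV
  coprod_mem : ∀ {V : GOrbit G} (hV : V ∈ F) {S : VSet V} {T : ∀ o : S.Orb, VSet (S.orbit o)},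
    S ∈ sets V hV → (∀ o, T o ∈ sets (S.orbit o) (F.closed (S.orbitMap o) hV)) →
    S.indexedCoprod T ∈ sets V hV

/-- A `G`-weak indexing system. -/
abbrev GWIndSys (G : Type) [Group G] := WIndSys (Family.all G)

namespace WIndSys

variable {G : Type} [Group G] {F : Family G}

/-- Weak indexing systems are ordered by inclusion. -/
instance : PartialOrder (WIndSys F) where
  le I J := ∀ (V : GOrbit G) (hV : V ∈ F), I.sets V hV ⊆ J.sets V hV
  le_refl _ _ _ := subset_rfl
  le_trans _ _ _ h h' V hV := (h V hV).trans (h' V hV)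
  le_antisymm I J h h' := WIndSys.ext (funext fun V => funext fun hV => (h V hV).antisymm (h' V hV))

/-- Meets are intersections. -/
instance : InfSet (WIndSys F) where
  sInf A :=
    { sets := fun V hV => {S | ∀ I ∈ A, S ∈ I.sets V hV}
      iso_mem := fun hV _ _ e h I hI => I.iso_mem hV e (h I hI)
      res_mem := fun hV f _ h I hI => I.res_mem hV f (h I hI)
      point_mem := fun hV ⟨S, h⟩ I hI => I.point_mem hV ⟨S, h I hI⟩
      coprod_mem := fun hV _ _ h h' I hI => I.coprod_mem hV (h I hI) fun o => h' o I hI }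

/-- The poset of weak indexing systems is a complete lattice. In particular `I ⊔ J` denotes the
join of `I` and `J` in it. -/
instance : CompleteLattice (WIndSys F) :=
  completeLatticeOfInf _ fun _ =>
    ⟨fun I hI _ _ _ h => h I hI, fun _ hJ V hV _ h _ hI => hJ hI V hV h⟩

/-- The least weak indexing system containing a given collection of `V`-sets. -/
def closure (C : ∀ V : GOrbit G, V ∈ F → Set (VSet V)) : WIndSys F :=
  sInf {I | ∀ (V : GOrbit G) (hV : V ∈ F), C V hV ⊆ I.sets V hV}

/-! ### Unitality conditions -/

/-- `I` has one color. -/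
def HasOneColor (I : WIndSys F) : Prop :=
  ∀ (V : GOrbit G) (hV : V ∈ F), (I.sets V hV).Nonempty

/-- `I` is almost essentially unital: it is closed under summands of noncontractible sets. -/
def IsAlmostEssentiallyUnital (I : WIndSys F) : Prop :=
  ∀ (V : GOrbit G) (hV : V ∈ F) (S S' : VSet V), ¬ (S.sum S').Iso (VSet.point V) →
    S.sum S' ∈ I.sets V hV → S ∈ I.sets V hV ∧ S' ∈ I.sets V hV

/-- `I` is almost unital. -/
def IsAlmostUnital (I : WIndSys F) : Prop :=
  I.IsAlmostEssentiallyUnital ∧ I.HasOneColor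

/-- `I` is unital: it has one color and is closed under summands. -/
def IsUnital (I : WIndSys F) : Prop :=
  I.HasOneColor ∧ ∀ (V : GOrbit G) (hV : V ∈ F) (S S' : VSet V),
    S.sum S' ∈ I.sets V hV → S ∈ I.sets V hV ∧ S' ∈ I.sets V hV

/-- `I` is an indexing system: each of its values is closed under finite coproducts. -/
def IsIndexingSystem (I : WIndSys F) : Prop :=
  ∀ (V : GOrbit G) (hV : V ∈ F), VSet.empty V ∈ I.sets V hV ∧
    ∀ S S' : VSet V, S ∈ I.sets V hV → S' ∈ I.sets V hV → S.sum S' ∈ I.sets V hV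

end WIndSys

/-! ### Auxiliary facts on `V`-sets -/

section Aux

variable {G : Type} [Group G] {V : GOrbit G}

theorem VSet.Iso.symm {S T : VSet V} (h : S.Iso T) : T.Iso S := by
  obtain ⟨e, he, hp⟩ := h
  obtain ⟨i, hl, hr⟩ := Function.bijective_iff_has_inverse.1 he
  refine ⟨⟨i, fun g x => he.1 ?_⟩, ⟨hr.injective, hl.surjective⟩, fun x => ?_⟩
  · have : e (i (g • x)) = g • x := hr _
    rw [this, id, map_smul e g (i x)]
    congr 1
    exact (hr x).symm
  · have : e (i x) = x := hr x
    rw [← hp]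
    exact congrArg T.proj this

theorem VSet.iso_point_iff {S : VSet V} :
    S.Iso (VSet.point V) ↔ Function.Bijective S.proj := by
  constructor
  · rintro ⟨e, he, hp⟩
    have : (S.proj : S.total → V) = e := funext fun x => (hp x).symm
    rw [this]; exact he
  · exact fun h => ⟨S.proj, h, fun _ => rfl⟩

theorem VSet.iso_empty_iff {S : VSet V} : S.Iso (VSet.empty V) ↔ IsEmpty S.total := by
  constructor
  · rintro ⟨e, -, -⟩
    exact ⟨fun x => (e x : Empty).elim⟩
  · intro h
    exact ⟨⟨fun x => h.elim x, fun _ x => h.elim x⟩,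
      ⟨fun x => h.elim x, fun y => Empty.elim y⟩, fun x => h.elim x⟩

/-- `S` is isomorphic to some `n · *_V` if and only if stabilizers of points of `S` are the
stabilizers of their images in `V`. -/
theorem VSet.iso_copies_iff {S : VSet V} :
    (∃ n, S.Iso (VSet.copies n V)) ↔
      ∀ (g : G) (x : S.total), g • S.proj x = S.proj x → g • x = x := by
  constructor
  · rintro ⟨n, e, he, hp⟩ g x h
    apply he.1
    rw [map_smul]
    rw [← hp] at h
    exact Sigma.ext rfl (heq_of_eq h)
  · intro h
    obtain ⟨v⟩ := V.nonempty
    choose t ht using fun w : V => MulAction.exists_smul_eq G v w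
    obtain ⟨n, ⟨eq⟩⟩ := Finite.exists_equiv_fin {x : S.total // S.proj x = v}
    have key : ∀ (g g' : G) (x : S.total), S.proj x = v → g • v = g' • v → g • x = g' • x := by
      intro g g' x hx hg
      have : (g'⁻¹ * g) • x = x := h _ _ (by rw [hx, mul_smul, hg, inv_smul_smul])
      rw [mul_smul, inv_smul_eq_iff] at this
      exact this
    have hbase : ∀ x : S.total, S.proj ((t (S.proj x))⁻¹ • x) = v := fun x => by
      rw [map_smul, inv_smul_eq_iff, ht]
    refine ⟨n, VSet.Iso.symm ⟨⟨fun y => t y.2 • (eq.symm y.1).1, ?_⟩, ⟨?_, ?_⟩, ?_⟩⟩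
    · rintro g ⟨i, w⟩
      change t (g • w) • (eq.symm i).1 = g • t w • (eq.symm i).1
      rw [← mul_smul]
      exact key _ _ _ (eq.symm i).2 (by rw [ht, mul_smul, ht])
    · rintro ⟨i, w⟩ ⟨j, u⟩ hxy
      change t w • (eq.symm i).1 = t u • (eq.symm j).1 at hxy
      have hwu : w = u := by
        have := congrArg S.proj hxy
        rwa [map_smul, map_smul, (eq.symm i).2, (eq.symm j).2, ht, ht] at this
      subst hwu
      have := eq.symm.injective (Subtype.ext (MulAction.injective _ hxy))
      subst this
      rfl
    · intro x
      refine ⟨⟨eq ⟨(t (S.proj x))⁻¹ • x, hbase x⟩, S.proj x⟩, ?_⟩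
      change t (S.proj x) • (eq.symm (eq _)).1 = x
      rw [Equiv.symm_apply_apply]
      exact smul_inv_smul _ _
    · rintro ⟨i, w⟩
      change S.proj (t w • (eq.symm i).1) = w
      rw [map_smul, (eq.symm i).2, ht]

/-- For a `G`-representation, the fibre of `S` over each point `v` of `V` embeds equivariantly
with respect to the stabilizer of `v` if and only if there is a `G`-equivariant map out of `S`
that is injective on each fibre. -/
theorem VSet.embeds_iff {R : Type*} [AddCommGroup R] [Module ℝ R] (ρ : Representation ℝ G R)
    {S : VSet V} :
    (∀ v : V, ∃ φ : {x : S.total // S.proj x = v} → R, Function.Injective φ ∧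
      ∀ (g : G) (x y : {x : S.total // S.proj x = v}), g • v = v → g • x.1 = y.1 →
        φ y = ρ g (φ x)) ↔
    ∃ ψ : S.total → R, (∀ (g : G) (x : S.total), ψ (g • x) = ρ g (ψ x)) ∧
      ∀ x y, S.proj x = S.proj y → ψ x = ψ y → x = y := by
  constructor
  · intro h
    obtain ⟨v⟩ := V.nonempty
    obtain ⟨φ, hφ, heq⟩ := h v
    choose t ht using fun w : V => MulAction.exists_smul_eq G v w
    have hbase : ∀ x : S.total, S.proj ((t (S.proj x))⁻¹ • x) = v := fun x => by
      rw [map_smul, inv_smul_eq_iff, ht]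
    refine ⟨fun x => ρ (t (S.proj x)) (φ ⟨_, hbase x⟩), fun g x => ?_, fun x y hxy hψ => ?_⟩
    · change ρ (t (S.proj (g • x))) (φ ⟨_, hbase (g • x)⟩) =
        ρ g (ρ (t (S.proj x)) (φ ⟨_, hbase x⟩))
      rw [heq ((t (S.proj (g • x)))⁻¹ * g * t (S.proj x)) ⟨_, hbase x⟩ ⟨_, hbase (g • x)⟩]
      · rw [← Module.End.mul_apply, ← map_mul, ← Module.End.mul_apply, ← map_mul]
        congr 2
        group
      · rw [mul_smul, ht, mul_smul, inv_smul_eq_iff, ht, map_smul]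
      · simp only [mul_smul, smul_inv_smul]
    · have hinj : Function.Injective (ρ (t (S.proj x))) := by
        intro a b hab
        have := congrArg (ρ (t (S.proj x))⁻¹) hab
        simpa [← Module.End.mul_apply, ← map_mul] using this
      simp only [← hxy] at hψ
      have := congrArg Subtype.val (hφ (hinj hψ))
      exact MulAction.injective _ this
  · rintro ⟨ψ, hψ, hinj⟩ v
    refine ⟨fun x => ψ x.1, fun x y h => Subtype.ext (hinj _ _ (x.2.trans y.2.symm) h), ?_⟩
    intro g x y _ h
    change ψ y.1 = ρ g (ψ x.1)
    rw [← h, hψ]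

theorem VSet.Iso.trans {S T W : VSet V} (h : S.Iso T) (h' : T.Iso W) : S.Iso W := by
  obtain ⟨e, he, hp⟩ := h
  obtain ⟨i, hi, hq⟩ := h'
  exact ⟨i.comp e, hi.comp he, fun x => (hq _).trans (hp x)⟩

theorem VSet.res_bijective {U : GOrbit G} (f : U →[G] V) {S : VSet V}
    (h : Function.Bijective S.proj) : Function.Bijective (S.res f).proj := by
  constructor
  · intro x y hxy
    have hxy : x.1.1 = y.1.1 := hxy
    exact Subtype.ext (Prod.ext hxy (h.1 (by rw [← x.2, ← y.2, hxy])))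
  · intro u
    obtain ⟨s, hs⟩ := h.2 (f u)
    exact ⟨⟨(u, s), hs.symm⟩, rfl⟩

/-- The map from an `S`-indexed coproduct to `S`. -/
def VSet.toBase {S : VSet V} {T : ∀ o : S.Orb, VSet (S.orbit o)}
    (x : (S.indexedCoprod T).total) : S.total :=
  ((T x.1).proj x.2).1

theorem VSet.coprod_bijective {S : VSet V} {T : ∀ o : S.Orb, VSet (S.orbit o)}
    (h : Function.Bijective S.proj) (h' : ∀ o, Function.Bijective (T o).proj) :
    Function.Bijective (S.indexedCoprod T).proj := by
  constructor
  · rintro ⟨o, x⟩ ⟨o', y⟩ hxy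
    have hbase : ((T o).proj x).1 = ((T o').proj y).1 := h.1 hxy
    have ho : o = o' := by
      have h1 := MulAction.orbitRel.Quotient.mem_orbit.1 ((T o).proj x).2
      have h2 := MulAction.orbitRel.Quotient.mem_orbit.1 ((T o').proj y).2
      rw [← h1, ← h2]
      exact congrArg _ hbase
    subst ho
    exact Sigma.ext rfl (heq_of_eq ((h' o).1 (Subtype.ext hbase)))
  · intro v
    obtain ⟨s, hs⟩ := h.2 v
    let o : S.Orb := Quotient.mk'' s
    obtain ⟨x, hx⟩ := (h' o).2 ⟨s, MulAction.orbitRel.Quotient.mem_orbit.2 rfl⟩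
    refine ⟨⟨o, x⟩, ?_⟩
    change S.proj ((T o).proj x).1 = v
    rw [hx, hs]

end Aux

/-! ### Examples of weak indexing systems -/

namespace WIndSys

variable {G : Type} [Group G] (F : Family G)

/-- The empty weak indexing system. -/
def empty : WIndSys F where
  sets _ _ := ∅
  iso_mem _ _ _ _ h := h
  res_mem _ _ _ h := h
  point_mem _ h := h.some_mem
  coprod_mem _ _ _ h _ := h

/-- The terminal weak indexing system, consisting of all finite `V`-sets. -/
def complete : WIndSys F where
  sets _ _ := Set.univ
  iso_mem _ _ _ _ _ := trivial
  res_mem _ _ _ _ := trivial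
  point_mem _ _ := trivial
  coprod_mem _ _ _ _ _ := trivial

/-- The weak indexing system `F^triv`, with `V`-value `{*_V}`. -/
def triv : WIndSys F where
  sets V _ := {S | S.Iso (VSet.point V)}
  iso_mem _ _ _ e h := e.symm.trans h
  res_mem _ f _ h := by
    obtain h := VSet.iso_point_iff.1 h
    exact VSet.iso_point_iff.2 (VSet.res_bijective f h)
  point_mem _ _ := VSet.iso_point_iff.2 Function.bijective_id
  coprod_mem _ _ _ h h' :=
    VSet.iso_point_iff.2 (VSet.coprod_bijective (VSet.iso_point_iff.1 h)
      fun o => VSet.iso_point_iff.1 (h' o))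

/-- The weak indexing system `F^0`, with `V`-value `{∅_V, *_V}`. -/
def zero : WIndSys F where
  sets V _ := {S | S.Iso (VSet.empty V) ∨ S.Iso (VSet.point V)}
  iso_mem _ _ _ e h := h.imp e.symm.trans e.symm.trans
  res_mem _ f S h := by
    refine h.imp (fun h => ?_) (fun h => ?_)
    · have := VSet.iso_empty_iff.1 h
      exact VSet.iso_empty_iff.2 ⟨fun x => this.false x.1.2⟩
    · exact VSet.iso_point_iff.2 (VSet.res_bijective f (VSet.iso_point_iff.1 h))
  point_mem _ _ := Or.inr (VSet.iso_point_iff.2 Function.bijective_id)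
  coprod_mem {V} _ S T h h' := by
    by_cases hT : ∀ o, (T o).Iso (VSet.point _)
    · rcases h with h | h
      · have := VSet.iso_empty_iff.1 h
        exact Or.inl (VSet.iso_empty_iff.2 ⟨fun x => this.false (VSet.toBase x)⟩)
      · exact Or.inr (VSet.iso_point_iff.2 (VSet.coprod_bijective (VSet.iso_point_iff.1 h)
          fun o => VSet.iso_point_iff.1 (hT o)))
    · push Not at hT
      obtain ⟨o, ho⟩ := hT
      have hoe := VSet.iso_empty_iff.1 ((h' o).resolve_right ho)
      have hS : ∀ o', o' = o := by
        rcases h with h | h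
        · have := VSet.iso_empty_iff.1 h
          obtain ⟨y, -⟩ := MulAction.orbitRel.Quotient.nonempty_orbit o
          exact (this.false y).elim
        · have hb := VSet.iso_point_iff.1 h
          intro o'
          induction o using Quotient.inductionOn with | _ x
          induction o' using Quotient.inductionOn with | _ y
          obtain ⟨g, hg⟩ := MulAction.exists_smul_eq G (S.proj x) (S.proj y)
          exact Quotient.sound ⟨g, hb.1 (by simpa [map_smul] using hg)⟩
      refine Or.inl (VSet.iso_empty_iff.2 ⟨?_⟩)
      rintro ⟨o', x⟩
      obtain rfl := hS o'
      exact hoe.false x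

/-- The weak indexing system `F^∞`, with `V`-value `{n · *_V | n ∈ ℕ}`. -/
def infty : WIndSys F where
  sets V _ := {S | ∃ n, S.Iso (VSet.copies n V)}
  iso_mem _ _ _ e h := h.imp fun _ => e.symm.trans
  res_mem _ f S h := by
    have h := VSet.iso_copies_iff.1 h
    refine VSet.iso_copies_iff.2 fun g x hx => Subtype.ext (Prod.ext hx (h g x.1.2 ?_))
    rw [← x.2, ← map_smul]
    exact congrArg f hx
  point_mem _ _ := VSet.iso_copies_iff.2 fun _ _ h => h
  coprod_mem _ S T h h' := by
    have h := VSet.iso_copies_iff.1 h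
    refine VSet.iso_copies_iff.2 ?_
    rintro g ⟨o, x⟩ hx
    have h1 := h g ((T o).proj x).1 hx
    have h2 := VSet.iso_copies_iff.1 (h' o) g x (Subtype.ext h1)
    exact Sigma.ext rfl (heq_of_eq h2)

/-- The weak indexing system `F^R` of a real `G`-representation `R`: its value at `V = G/H`
consists of the finite `H`-sets which admit an `H`-equivariant embedding into `R`. A `V`-set `S`
is identified with its fibre over a point `v` with stabilizer `H`. -/
def ofRep {R : Type*} [AddCommGroup R] [Module ℝ R] (ρ : Representation ℝ G R) : WIndSys F where
  sets V _ := {S | ∀ v : V, ∃ φ : {x : S.total // S.proj x = v} → R, Function.Injective φ ∧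
    ∀ (g : G) (x y : {x : S.total // S.proj x = v}), g • v = v → g • x.1 = y.1 →
      φ y = ρ g (φ x)}
  iso_mem _ S T e h := by
    obtain ⟨ψ, hψ, hi⟩ := (VSet.embeds_iff ρ).1 h
    obtain ⟨i, hb, hp⟩ := e.symm
    refine (VSet.embeds_iff ρ).2 ⟨fun x => ψ (i x), fun g x => ?_, fun x y hxy hxy' => ?_⟩
    · change ψ (i (g • x)) = _
      rw [map_smul, hψ]
    · exact hb.1 (hi _ _ (by rw [hp, hp, hxy]) hxy')
  res_mem _ f S h := by
    obtain ⟨ψ, hψ, hi⟩ := (VSet.embeds_iff ρ).1 h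
    refine (VSet.embeds_iff ρ).2 ⟨fun x => ψ x.1.2, fun g x => hψ g x.1.2, fun x y hxy hxy' => ?_⟩
    have hxy : x.1.1 = y.1.1 := hxy
    exact Subtype.ext (Prod.ext hxy (hi _ _ (by rw [← x.2, ← y.2, hxy]) hxy'))
  point_mem _ _ := (VSet.embeds_iff ρ).2
    ⟨fun _ => 0, fun g _ => (map_zero (ρ g)).symm, fun _ _ h _ => h⟩
  coprod_mem _ S T h h' := by
    obtain ⟨ψ, hψ, hi⟩ := (VSet.embeds_iff ρ).1 h
    choose χ hχ hj using fun o => (VSet.embeds_iff ρ).1 (h' o)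
    -- perturb the embedding of `S` by a small multiple of the embeddings of the `T o`
    let X := (S.indexedCoprod T).total
    let a : X → R := fun x => ψ (VSet.toBase x)
    let b : X → R := fun x => χ x.1 x.2
    obtain ⟨c, hc0, hc⟩ : ∃ c : ℝ, c ≠ 0 ∧
        ∀ x y : X, a x + c • b x = a y + c • b y → a x = a y := by
      let bad : X × X → Set ℝ :=
        fun q => {c | a q.1 + c • b q.1 = a q.2 + c • b q.2 ∧ a q.1 ≠ a q.2}
      have hbad : ∀ q, (bad q).Finite := fun q => by
        refine Set.Subsingleton.finite ?_
        rintro c ⟨hc, hne⟩ d ⟨hd, -⟩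
        by_contra hcd
        have h1 : (c - d) • (b q.1 - b q.2) = 0 := by
          have : (c - d) • (b q.1 - b q.2) = (a q.1 + c • b q.1 - (a q.2 + c • b q.2)) -
            (a q.1 + d • b q.1 - (a q.2 + d • b q.2)) := by module
          rw [this, hc, hd]; simp
        have h2 : b q.1 = b q.2 :=
          sub_eq_zero.1 ((smul_eq_zero.1 h1).resolve_left (sub_ne_zero.2 hcd))
        rw [h2] at hc
        exact hne (add_right_cancel hc)
      obtain ⟨c, hc⟩ := ((Set.finite_iUnion hbad).union (Set.finite_singleton 0)).exists_notMem
      rw [Set.mem_union, not_or] at hc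
      refine ⟨c, hc.2, fun x y hxy => ?_⟩
      by_contra hne
      exact hc.1 (Set.mem_iUnion.2 ⟨(x, y), hxy, hne⟩)
    refine (VSet.embeds_iff ρ).2 ⟨fun x => a x + c • b x, ?_, ?_⟩
    · rintro g ⟨o, x⟩
      have h1 : a (g • (⟨o, x⟩ : X)) = ρ g (a ⟨o, x⟩) := by
        rw [← hψ]
        exact congrArg (fun z => ψ z.1) (map_smul (T o).proj g x)
      have h2 : b (g • (⟨o, x⟩ : X)) = ρ g (b ⟨o, x⟩) := hχ o g x
      change a (g • (⟨o, x⟩ : X)) + c • b (g • (⟨o, x⟩ : X)) = _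
      rw [h1, h2, map_add, map_smul]
    · rintro ⟨o, x⟩ ⟨o', y⟩ hp hxy
      have hbase : VSet.toBase (⟨o, x⟩ : X) = VSet.toBase (⟨o', y⟩ : X) :=
        hi _ _ hp (hc _ _ hxy)
      have ho : o = o' := by
        have h1 := MulAction.orbitRel.Quotient.mem_orbit.1 ((T o).proj x).2
        have h2 := MulAction.orbitRel.Quotient.mem_orbit.1 ((T o').proj y).2
        rw [← h1, ← h2]
        exact congrArg _ hbase
      subst ho
      refine Sigma.ext rfl (heq_of_eq (hj o x y (Subtype.ext hbase) ?_))
      have hab : a ⟨o, x⟩ = a ⟨o, y⟩ := hc _ _ hxy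
      have hxy : a ⟨o, x⟩ + c • χ o x = a ⟨o, y⟩ + c • χ o y := hxy
      rw [hab] at hxy
      exact smul_right_injective R hc0 (add_left_cancel hxy)

/-- The `G`-weak indexing system `E_F^G I`, equal to `I` over the family `F` and empty
elsewhere. -/
def extend {F : Family G} (I : WIndSys F) : GWIndSys G where
  sets V _ := {S | ∃ hV : V ∈ F, S ∈ I.sets V hV}
  iso_mem _ _ _ e := fun ⟨hV, h⟩ => ⟨hV, I.iso_mem hV e h⟩
  res_mem _ f _ := fun ⟨hV, h⟩ => ⟨_, I.res_mem hV f h⟩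
  point_mem _ := fun ⟨S, hV, h⟩ => ⟨hV, I.point_mem hV ⟨S, h⟩⟩
  coprod_mem _ _ _ := fun ⟨hV, h⟩ h' => ⟨hV, I.coprod_mem hV h fun o => (h' o).2⟩

end WIndSys

/-! ### Transfer systems -/

/-- A transfer system: a wide subcategory of the orbit category that contains all isomorphisms
and satisfies base change, i.e. for each commutative square with `α : V → U` in `R` such that
`V' → V ×_U U'` is a summand inclusion, `α' : V' → U'` is in `R`. -/
structure TransferSystem (G : Type) [Group G] where
  maps : ∀ U V : GOrbit G, Set (U →[G] V)
  iso_mem : ∀ {U V : GOrbit G} (f : U →[G] V), Function.Bijective f → f ∈ maps U V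
  comp_mem : ∀ {U V W : GOrbit G} {g : V →[G] W} {f : U →[G] V},
    g ∈ maps V W → f ∈ maps U V → g.comp f ∈ maps U W
  baseChange : ∀ {V' V U' U : GOrbit G} (k : V' →[G] V) (α' : V' →[G] U') (α : V →[G] U)
    (f : U' →[G] U), (∀ x, α (k x) = f (α' x)) →
    (∀ x y, k x = k y → α' x = α' y → x = y) → α ∈ maps V U → α' ∈ maps V' U'

/-- The complete transfer system, containing all transfers. -/
def TransferSystem.complete (G : Type) [Group G] : TransferSystem G where
  maps _ _ := Set.univ
  iso_mem _ _ := trivial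
  comp_mem _ _ := trivial
  baseChange _ _ _ _ _ _ _ := trivial

/-- The weak indexing system `F̄_R` of a transfer system `R`: the join of `F^0` with the closure
of the collection of restrictions `Res_V^W U` of the `W`-sets `U → W` in `R`. The assignment
`R ↦ F̄_R` is left adjoint to sending a unital weak indexing system to its transfer system. -/
def TransferSystem.toWIndSys {G : Type} [Group G] (R : TransferSystem G) : GWIndSys G :=
  WIndSys.zero (Family.all G) ⊔ WIndSys.closure fun V _ =>
    {S | ∃ (U W : GOrbit G) (f : U →[G] W) (h : V →[G] W), f ∈ R.maps U W ∧
      S = (VSet.ofMap f).res h}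

/-! ### The cyclic group of order `p` and the Hasse diagram -/

/-- The cyclic group `C_p` of order `p`, written multiplicatively. -/
abbrev Cp (p : ℕ) : Type := Multiplicative (ZMod p)

/-- The 13 vertices of the Hasse diagram. -/
inductive Vertex
  | empty | extTriv | extZero | extInfty
  | triv | zeroE | trivJoinExtInfty
  | zero | inftyE | infty
  | overline | lam | complete

/-- The 16 arrows of the Hasse diagram. -/
inductive Arrow : Vertex → Vertex → Prop
  | empty_extTriv : Arrow .empty .extTriv
  | extTriv_extZero : Arrow .extTriv .extZero
  | extTriv_triv : Arrow .extTriv .triv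
  | extZero_extInfty : Arrow .extZero .extInfty
  | extZero_zeroE : Arrow .extZero .zeroE
  | extInfty_join : Arrow .extInfty .trivJoinExtInfty
  | triv_zeroE : Arrow .triv .zeroE
  | zeroE_join : Arrow .zeroE .trivJoinExtInfty
  | zeroE_zero : Arrow .zeroE .zero
  | join_inftyE : Arrow .trivJoinExtInfty .inftyE
  | zero_inftyE : Arrow .zero .inftyE
  | inftyE_infty : Arrow .inftyE .infty
  | inftyE_overline : Arrow .inftyE .overline
  | infty_complete : Arrow .infty .complete
  | overline_lam : Arrow .overline .lam
  | lam_complete : Arrow .lam .complete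

/-- The `C_p`-weak indexing systems at the vertices of the Hasse diagram, where `lam` is the
weak indexing system of the representation `ρ`. -/
def Vertex.system {p : ℕ} {L : Type*} [AddCommGroup L] [Module ℝ L]
    (ρ : Representation ℝ (Cp p) L) : Vertex → GWIndSys (Cp p)
  | empty => WIndSys.empty (Family.all (Cp p))
  | extTriv => (WIndSys.triv (Family.free (Cp p))).extend
  | extZero => (WIndSys.zero (Family.free (Cp p))).extend
  | extInfty => (WIndSys.infty (Family.free (Cp p))).extend
  | triv => WIndSys.triv (Family.all (Cp p))
  | zeroE => WIndSys.triv (Family.all (Cp p)) ⊔ (WIndSys.zero (Family.free (Cp p))).extend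
  | trivJoinExtInfty =>
      WIndSys.triv (Family.all (Cp p)) ⊔ (WIndSys.infty (Family.free (Cp p))).extend
  | zero => WIndSys.zero (Family.all (Cp p))
  | inftyE => WIndSys.zero (Family.all (Cp p)) ⊔ (WIndSys.infty (Family.free (Cp p))).extend
  | infty => WIndSys.infty (Family.all (Cp p))
  | overline => (TransferSystem.complete (Cp p)).toWIndSys
  | lam => WIndSys.ofRep (Family.all (Cp p)) ρ
  | complete => WIndSys.complete (Family.all (Cp p))

end WeakIndexing

open WeakIndexing

namespace WeakIndexing

open MulAction

/-! ### Actions of a cyclic group of prime order -/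

section CyclicActions

variable {p : ℕ} [Fact p.Prime]

/-! Since `p` is prime, every orbit of `C_p` is either a point or free, so a finite `V`-set is
determined up to isomorphism by its number of fixed points and its number of free orbits
(`VSet.iso_of_count`). A `C_p`-weak indexing system is therefore a set `A` of numbers `n` (over
`C_p/e`) together with a set `B` of pairs `(m, k)` (over `C_p/C_p`), subject to the arithmetic
closure conditions `Admissible`; inclusion of systems is inclusion of both sets (`admissible_val`,
`ofCounts`, `le_iff_val`).

Almost essential unitality makes `A` and `B` closed under passing to smaller counts, except below
the counts of the point. Then `B` is governed by which of `(0,1)`, `(2,0)`, `(1,1)`, `(0,0)`,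
`(1,0)` it contains, and `A` by which of `0`, `1` and some `n ≥ 2` it contains. The two interact
through restriction `(m, k) ↦ m + p * k`: either of `(0,1)` and `(2,0)` puts a number at least `2`
into `A` and so forces `A` to be everything. The case analysis `Admissible.exists_vertex` leaves 13
pairs.

It remains to compute the counts of the 13 named systems (`val_vertex`). A join is found by checking
that the expected counts are admissible (`val_sup`, `val_overline`). For the representation,
invariant vectors vanish and all other vectors have trivial stabilizer, so an embedding exists
exactly when there is at most one fixed point (`mem_ofRep_iff`). Order, covering relations and the
unitality conditions then become finite checks on a few counts (`Vertex.tfae_le`, `isUnital_iff`,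
`isIndexingSystem_iff`). -/

theorem Cp.natCard : Nat.card (Cp p) = p := by
  simp [Nat.card_eq_fintype_card, ZMod.card]

instance : Finite (Cp p) := Nat.finite_of_card_ne_zero (by
  rw [Cp.natCard]; exact (Fact.out : p.Prime).ne_zero)

instance : Nontrivial (Cp p) := Finite.one_lt_card_iff_nontrivial.1 (by
  rw [Cp.natCard]; exact (Fact.out : p.Prime).one_lt)

/-- The stabilizer of `x` is a subgroup of a group of prime order, hence trivial or everything. -/
theorem smul_eq_self_imp_eq_one {X : Type} [MulAction (Cp p) X] {x : X}
    (hx : x ∉ fixedPoints (Cp p) X) {g : Cp p} (hg : g • x = x) : g = 1 := by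
  have hp : (Nat.card (Cp p)).Prime := by rw [Cp.natCard]; exact Fact.out
  have := Fact.mk hp
  rcases (stabilizer (Cp p) x).eq_bot_or_eq_top_of_prime_card with h | h
  · have : g ∈ stabilizer (Cp p) x := hg
    rwa [h, Subgroup.mem_bot] at this
  · refine (hx fun g => ?_).elim
    have : g ∈ stabilizer (Cp p) x := h ▸ Subgroup.mem_top g
    exact this

/-- An orbit on which the group acts trivially, i.e. one isomorphic to `G/G`. -/
def GOrbit.IsFixed {G : Type} [Group G] (V : GOrbit G) : Prop := ∀ (g : G) (v : V), g • v = v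

theorem GOrbit.IsFixed.subsingleton {G : Type} [Group G] {V : GOrbit G} (hV : V.IsFixed) :
    Subsingleton V :=
  ⟨fun v w => by obtain ⟨g, hg⟩ := exists_smul_eq G v w; rw [← hg, hV]⟩

theorem GOrbit.isFixed_or_mem_free (V : GOrbit (Cp p)) :
    V.IsFixed ∨ V ∈ Family.free (Cp p) := by
  by_cases h : ∃ v : V, v ∈ fixedPoints (Cp p) V
  · obtain ⟨v, hv⟩ := h
    refine Or.inl fun g w => ?_
    obtain ⟨k, rfl⟩ := exists_smul_eq (Cp p) v w
    rw [hv k, hv g]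
  · push Not at h
    exact Or.inr fun g x hg => smul_eq_self_imp_eq_one (h x) hg

theorem GOrbit.IsFixed.not_mem_free {V : GOrbit (Cp p)} (hV : V.IsFixed) :
    V ∉ Family.free (Cp p) := by
  intro h
  obtain ⟨g, hg⟩ := exists_ne (1 : Cp p)
  obtain ⟨v⟩ := V.nonempty
  exact hg (h g v (hV g v))

theorem GOrbit.natCard_eq_one_of_isFixed {V : GOrbit (Cp p)} (hV : V.IsFixed) :
    Nat.card V = 1 :=
  Nat.card_eq_one_iff_unique.2 ⟨hV.subsingleton, V.nonempty⟩

theorem GOrbit.natCard_eq_of_mem_free {V : GOrbit (Cp p)} (hV : V ∈ Family.free (Cp p)) :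
    Nat.card V = p := by
  obtain ⟨v⟩ := V.nonempty
  refine Eq.trans ?_ Cp.natCard
  refine (Nat.card_congr (Equiv.ofBijective (fun g : Cp p => g • v)
    ⟨fun g k h => ?_, fun w => ?_⟩)).symm
  · have h : g • v = k • v := h
    have := hV (k⁻¹ * g) v (by rw [mul_smul, h, inv_smul_smul])
    exact (inv_mul_eq_one.1 this).symm
  · exact exists_smul_eq (Cp p) v w

/-- The orbit `G/G`. -/
def GOrbit.pt (G : Type) [Group G] : GOrbit G where
  carrier := Unit
  action := { smul := fun _ x => x, one_smul := fun _ => rfl, mul_smul := fun _ _ _ => rfl }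
  transitive := ⟨fun _ _ => ⟨1, rfl⟩⟩

/-- The orbit `G/e`. -/
def GOrbit.regular (G : Type) [Group G] [Finite G] : GOrbit G where
  carrier := G

theorem GOrbit.isFixed_pt {G : Type} [Group G] : (GOrbit.pt G).IsFixed := fun _ _ => rfl

theorem GOrbit.regular_mem_free {G : Type} [Group G] [Finite G] :
    GOrbit.regular G ∈ Family.free G := fun g x h => by
  have h : (g * (show G from x) : G) = (show G from x) := h
  exact mul_eq_right.1 h

/-- Any free orbit maps to any other orbit. -/
theorem GOrbit.exists_hom_of_mem_free {G : Type} [Group G] {U : GOrbit G}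
    (hU : U ∈ Family.free G) (V : GOrbit G) : Nonempty (U →[G] V) := by
  obtain ⟨u⟩ := U.nonempty
  obtain ⟨v⟩ := V.nonempty
  choose t ht using fun w : U => exists_smul_eq G u w
  refine ⟨⟨fun w => t w • v, fun g w => ?_⟩⟩
  have : t (g • w) = g * t w := by
    have := hU ((g * t w)⁻¹ * t (g • w)) u (by
      rw [mul_smul, ht, inv_smul_eq_iff, mul_smul, ht])
    exact (inv_mul_eq_one.1 this).symm
  rw [this, mul_smul, id]

/-- Any orbit maps to any trivial orbit. -/
theorem GOrbit.exists_hom_of_isFixed {G : Type} [Group G] (U : GOrbit G) {V : GOrbit G}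
    (hV : V.IsFixed) : Nonempty (U →[G] V) := by
  obtain ⟨v⟩ := V.nonempty
  exact ⟨⟨fun _ => v, fun g _ => (hV g v).symm⟩⟩

theorem GOrbit.hom_surjective {G : Type} [Group G] {U V : GOrbit G} (f : U →[G] V) :
    Function.Surjective f := fun v => by
  obtain ⟨u⟩ := U.nonempty
  obtain ⟨g, hg⟩ := exists_smul_eq G (f u) v
  exact ⟨g • u, by rw [map_smul, hg]⟩

/-- With the next lemma: a map between two orbits of the same type is an isomorphism, so the only
restriction that can change counts goes from a fixed orbit to a free one. -/
theorem GOrbit.hom_bijective_of_mem_free {G : Type} [Group G] {U V : GOrbit G}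
    (hV : V ∈ Family.free G) (f : U →[G] V) : Function.Bijective f := by
  refine ⟨fun u w h => ?_, hom_surjective f⟩
  obtain ⟨g, rfl⟩ := exists_smul_eq G u w
  rw [map_smul] at h
  rw [hV g _ h.symm, one_smul]

theorem GOrbit.hom_bijective_of_isFixed {G : Type} [Group G] {U V : GOrbit G}
    (hU : U.IsFixed) (f : U →[G] V) : Function.Bijective f :=
  ⟨fun _ _ _ => hU.subsingleton.elim _ _, hom_surjective f⟩

end CyclicActions

/-! ### Counting orbits of finite `V`-sets -/

section Counting

variable {p : ℕ} [Fact p.Prime] {V : GOrbit (Cp p)}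

/-- The number of fixed points of a `V`-set. -/
noncomputable def VSet.nfix (S : VSet V) : ℕ := Nat.card (fixedPoints (Cp p) S.total)

/-- The number of free orbits of a `V`-set. -/
noncomputable def VSet.nfree (S : VSet V) : ℕ := (Nat.card S.total - S.nfix) / p

/-- The finite `C_p`-set with `m` fixed points and `k` free orbits. -/
def FinGSet.model (m k : ℕ) : FinGSet (Cp p) where
  carrier := Fin m ⊕ (Fin k × Cp p)
  action :=
    { smul := fun g x => Sum.map id (fun y => (y.1, g * y.2)) x
      one_smul := by
        rintro (x | x)
        · rfl
        · exact congrArg Sum.inr (Prod.ext rfl (one_mul _))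
      mul_smul := by
        rintro g g' (x | x)
        · rfl
        · exact congrArg Sum.inr (Prod.ext rfl (mul_assoc _ _ _)) }

/-- The `V`-set with `m` fixed points and `k` free orbits. -/
def VSet.model (v : V) (m k : ℕ) (h : 0 < m → V.IsFixed) : VSet V where
  total := FinGSet.model m k
  proj :=
    { toFun := Sum.elim (fun _ => v) fun y => y.2 • v
      map_smul' := by
        rintro g (x | x)
        · exact (h x.pos g v).symm
        · exact mul_smul _ _ _ }

theorem VSet.natCard_model (v : V) (m k : ℕ) (h : 0 < m → V.IsFixed) :
    Nat.card (VSet.model v m k h).total = m + p * k := by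
  change Nat.card (Fin m ⊕ (Fin k × Cp p)) = _
  rw [Nat.card_sum, Nat.card_prod, Cp.natCard, Nat.card_fin, Nat.card_fin, mul_comm]

theorem VSet.nfix_model (v : V) (m k : ℕ) (h : 0 < m → V.IsFixed) :
    (VSet.model v m k h).nfix = m := by
  have : Function.Bijective (fun i : Fin m =>
      (⟨Sum.inl i, fun _ => rfl⟩ : fixedPoints (Cp p) (VSet.model v m k h).total)) := by
    refine ⟨fun i j hij => Sum.inl_injective (congrArg Subtype.val hij), ?_⟩
    rintro ⟨i | ⟨j, k⟩, hi⟩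
    · exact ⟨i, rfl⟩
    · obtain ⟨g, hg⟩ := exists_ne (1 : Cp p)
      have := congrArg Prod.snd (Sum.inr_injective (hi g))
      exact (hg (mul_eq_right.1 this)).elim
  rw [VSet.nfix, ← Nat.card_congr (Equiv.ofBijective _ this), Nat.card_fin]

theorem VSet.nfree_model (v : V) (m k : ℕ) (h : 0 < m → V.IsFixed) :
    (VSet.model v m k h).nfree = k := by
  rw [VSet.nfree, VSet.natCard_model, VSet.nfix_model, Nat.add_sub_cancel_left,
    Nat.mul_div_cancel_left _ (Fact.out : p.Prime).pos]

theorem VSet.natCard_eq_of_iso {S T : VSet V} (h : S.Iso T) :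
    Nat.card S.total = Nat.card T.total := by
  obtain ⟨e, he, -⟩ := h
  exact Nat.card_congr (Equiv.ofBijective e he)

theorem natCard_fixedPoints_congr {G X Y : Type} [Group G] [MulAction G X] [MulAction G Y]
    (e : X →[G] Y) (he : Function.Bijective e) :
    Nat.card (fixedPoints G X) = Nat.card (fixedPoints G Y) := by
  refine Nat.card_congr ((Equiv.ofBijective e he).subtypeEquiv fun x => ?_)
  refine forall_congr' fun g => ?_
  change g • x = x ↔ g • e x = e x
  rw [← map_smul, he.1.eq_iff]

theorem VSet.nfix_eq_of_iso {S T : VSet V} (h : S.Iso T) : S.nfix = T.nfix := by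
  obtain ⟨e, he, -⟩ := h
  exact natCard_fixedPoints_congr e he

theorem VSet.nfree_eq_of_iso {S T : VSet V} (h : S.Iso T) : S.nfree = T.nfree := by
  rw [VSet.nfree, VSet.nfree, natCard_eq_of_iso h, nfix_eq_of_iso h]

/-- Fixed points are enumerated by `Fin m`. In every other orbit a base point lying over `v` is
chosen; its translates parametrize the orbit freely, and the choice over `v` makes the
parametrization compatible with the projections. -/
theorem VSet.exists_model_iso (v : V) (S : VSet V) :
    ∃ m k h, (VSet.model v m k h).Iso S := by
  obtain ⟨m, ⟨e⟩⟩ := Finite.exists_equiv_fin (fixedPoints (Cp p) S.total)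
  obtain ⟨k, ⟨f⟩⟩ := Finite.exists_equiv_fin
    {o : S.Orb // Quotient.out o ∉ fixedPoints (Cp p) S.total}
  have hrep : ∀ o : S.Orb, ∃ g : Cp p, S.proj (g • Quotient.out o) = v := fun o => by
    obtain ⟨g, hg⟩ := exists_smul_eq (Cp p) (S.proj (Quotient.out o)) v
    exact ⟨g, by rw [map_smul, hg]⟩
  choose t ht using hrep
  let r : S.Orb → S.total := fun o => t o • Quotient.out o
  have hr : ∀ o, (Quotient.mk'' (r o) : S.Orb) = o := fun o => by
    conv_rhs => rw [← Quotient.out_eq' o]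
    exact Quotient.sound ⟨t o, rfl⟩
  have hfix : ∀ (g : Cp p) (x : S.total), g • x ∈ fixedPoints (Cp p) S.total →
      x ∈ fixedPoints (Cp p) S.total := fun g x hx => by
    have := hx g⁻¹
    rw [inv_smul_smul] at this
    rwa [← this] at hx
  -- A fixed point of `S` projects to a fixed point of `V`, which a free orbit does not have.
  have h : 0 < m → V.IsFixed := fun hm => by
    obtain ⟨x, hx⟩ := e.symm ⟨0, hm⟩
    refine (GOrbit.isFixed_or_mem_free V).resolve_right fun hV => ?_
    obtain ⟨g, hg⟩ := exists_ne (1 : Cp p)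
    exact hg (hV g (S.proj x) (by rw [← map_smul, hx g]))
  let φ : Fin m ⊕ (Fin k × Cp p) → S.total :=
    Sum.elim (fun i => (e.symm i).1) fun y => y.2 • r (f.symm y.1).1
  refine ⟨m, k, h, ⟨φ, ?_⟩, ⟨?_, ?_⟩, ?_⟩
  · rintro g (i | ⟨j, k⟩)
    · exact ((e.symm i).2 g).symm
    · exact mul_smul _ _ _
  · have hne : ∀ i j g, (e.symm i).1 ≠ g • r (f.symm j).1 := fun i j g hij => by
      refine (f.symm j).2 (hfix (t (f.symm j).1) _ (hfix g (r (f.symm j).1) ?_))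
      exact hij ▸ (e.symm i).2
    rintro (i | ⟨j, g⟩) (i' | ⟨j', g'⟩) hij
    · exact congrArg Sum.inl (e.symm.injective (Subtype.ext hij))
    · exact (hne _ _ _ hij).elim
    · exact (hne _ _ _ hij.symm).elim
    · have hij : g • r (f.symm j).1 = g' • r (f.symm j').1 := hij
      have ho : (f.symm j).1 = (f.symm j').1 := by
        rw [← hr (f.symm j).1, ← hr (f.symm j').1]
        refine Quotient.sound ⟨g⁻¹ * g', ?_⟩
        change (g⁻¹ * g') • _ = _
        rw [mul_smul, ← hij, inv_smul_smul]
      obtain rfl := f.symm.injective (Subtype.ext ho)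
      have := smul_eq_self_imp_eq_one (x := r (f.symm j).1) (g := g'⁻¹ * g)
        (fun hx => (f.symm j).2 (hfix _ _ hx)) (by rw [mul_smul, hij, inv_smul_smul])
      rw [inv_mul_eq_one.1 this]
  · intro x
    by_cases hx : x ∈ fixedPoints (Cp p) S.total
    · exact ⟨Sum.inl (e ⟨x, hx⟩), congrArg Subtype.val (e.symm_apply_apply _)⟩
    · let o : S.Orb := Quotient.mk'' x
      obtain ⟨g, hg⟩ : ∃ g : Cp p, g • r o = x := by
        obtain ⟨g, hg⟩ := Quotient.exact (hr o)
        exact ⟨g⁻¹, by rw [inv_smul_eq_iff]; exact hg.symm⟩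
      have ho : Quotient.out o ∉ fixedPoints (Cp p) S.total := fun h => hx (by
        rw [← hg, show r o = _ from h _, h]; exact h)
      refine ⟨Sum.inr (f ⟨o, ho⟩, g), ?_⟩
      change g • r (f.symm (f ⟨o, ho⟩)).1 = x
      rw [Equiv.symm_apply_apply]
      exact hg
  · rintro (i | ⟨j, g⟩)
    · exact (h i.pos).subsingleton.elim _ _
    · change S.proj (g • r (f.symm j).1) = g • v
      rw [map_smul, ht]

/-- On the normal form this is a direct count. It shows that the truncated subtraction and the
division defining `nfree` are exact. -/
theorem VSet.natCard_total (S : VSet V) : Nat.card S.total = S.nfix + p * S.nfree := by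
  obtain ⟨v⟩ := V.nonempty
  obtain ⟨m, k, h, e⟩ := VSet.exists_model_iso v S
  rw [← natCard_eq_of_iso e, ← nfix_eq_of_iso e, ← nfree_eq_of_iso e, natCard_model, nfix_model,
    nfree_model]

/-- Finite `V`-sets are classified by their numbers of fixed points and free orbits. -/
theorem VSet.iso_of_count {S T : VSet V} (h : S.nfix = T.nfix) (h' : S.nfree = T.nfree) :
    S.Iso T := by
  obtain ⟨v⟩ := V.nonempty
  obtain ⟨m, k, hm, e⟩ := VSet.exists_model_iso v S
  obtain ⟨m', k', hm', e'⟩ := VSet.exists_model_iso v T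
  rw [← nfix_eq_of_iso e, ← nfix_eq_of_iso e', nfix_model, nfix_model] at h
  rw [← nfree_eq_of_iso e, ← nfree_eq_of_iso e', nfree_model, nfree_model] at h'
  subst h h'
  exact e.symm.trans e'

theorem VSet.nfree_eq_of_natCard {S : VSet V} {n : ℕ} (h : Nat.card S.total = S.nfix + p * n) :
    S.nfree = n := by
  have := S.natCard_total
  rw [h] at this
  exact (Nat.eq_of_mul_eq_mul_left (Fact.out : p.Prime).pos (Nat.add_left_cancel this)).symm

theorem VSet.nfix_eq_zero (hV : V ∈ Family.free (Cp p)) (S : VSet V) : S.nfix = 0 := by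
  obtain ⟨v⟩ := V.nonempty
  obtain ⟨m, k, h, e⟩ := VSet.exists_model_iso v S
  rw [← nfix_eq_of_iso e, nfix_model]
  by_contra hm
  exact (h (Nat.pos_of_ne_zero hm)).not_mem_free hV

/-! ### Counts of sums, indexed coproducts, points and restrictions -/

theorem VSet.nfix_sum (S T : VSet V) : (S.sum T).nfix = S.nfix + T.nfix := by
  rw [VSet.nfix, VSet.nfix, VSet.nfix, ← Nat.card_sum]
  refine (Nat.card_congr (Equiv.ofBijective (Sum.elim
    (fun x => (⟨Sum.inl x.1, fun g => congrArg Sum.inl (x.2 g)⟩ :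
      fixedPoints (Cp p) (S.sum T).total))
    (fun x => ⟨Sum.inr x.1, fun g => congrArg Sum.inr (x.2 g)⟩)) ⟨?_, ?_⟩)).symm
  · rintro (x | x) (y | y) h
    · exact congrArg Sum.inl (Subtype.ext (Sum.inl_injective (congrArg Subtype.val h)))
    · exact (Sum.inl_ne_inr (congrArg Subtype.val h)).elim
    · exact (Sum.inr_ne_inl (congrArg Subtype.val h)).elim
    · exact congrArg Sum.inr (Subtype.ext (Sum.inr_injective (congrArg Subtype.val h)))
  · rintro ⟨x | x, hx⟩
    · exact ⟨Sum.inl ⟨x, fun g => Sum.inl_injective (hx g)⟩, rfl⟩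
    · exact ⟨Sum.inr ⟨x, fun g => Sum.inr_injective (hx g)⟩, rfl⟩

theorem VSet.nfree_sum (S T : VSet V) : (S.sum T).nfree = S.nfree + T.nfree := by
  refine nfree_eq_of_natCard ?_
  have : Nat.card (S.sum T).total = Nat.card S.total + Nat.card T.total := Nat.card_sum
  rw [this, S.natCard_total, T.natCard_total, nfix_sum]
  ring

/-- The action on the coproduct preserves the index `o`, so a fixed point is a fixed point of a
single summand. -/
theorem VSet.nfix_indexedCoprod {S : VSet V} [Fintype S.Orb]
    (T : ∀ o : S.Orb, VSet (S.orbit o)) : (S.indexedCoprod T).nfix = ∑ o, (T o).nfix := by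
  have : ∑ o, (T o).nfix = Nat.card (Σ o, fixedPoints (Cp p) (T o).total) := by
    rw [Nat.card_sigma]; rfl
  rw [this]
  refine (Nat.card_congr (Equiv.ofBijective (fun x : Σ o, fixedPoints (Cp p) (T o).total =>
    (⟨⟨x.1, x.2.1⟩, fun g => Sigma.ext rfl (heq_of_eq (x.2.2 g))⟩ :
      fixedPoints (Cp p) (S.indexedCoprod T).total)) ⟨?_, ?_⟩)).symm
  · rintro ⟨o, x⟩ ⟨o', y⟩ h
    have h := congrArg Subtype.val h
    obtain rfl : o = o' := congrArg Sigma.fst h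
    exact Sigma.ext rfl (heq_of_eq (Subtype.ext (eq_of_heq (Sigma.ext_iff.1 h).2)))
  · rintro ⟨⟨o, x⟩, h⟩
    exact ⟨⟨o, x, fun g => eq_of_heq (Sigma.ext_iff.1 (h g)).2⟩, rfl⟩

theorem VSet.nfree_indexedCoprod {S : VSet V} [Fintype S.Orb]
    (T : ∀ o : S.Orb, VSet (S.orbit o)) : (S.indexedCoprod T).nfree = ∑ o, (T o).nfree := by
  refine nfree_eq_of_natCard ?_
  have : Nat.card (S.indexedCoprod T).total = ∑ o, Nat.card (T o).total := Nat.card_sigma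
  rw [this, nfix_indexedCoprod, Finset.mul_sum, ← Finset.sum_add_distrib]
  exact Finset.sum_congr rfl fun o _ => (T o).natCard_total

theorem VSet.nfix_point_of_isFixed (hV : V.IsFixed) : (VSet.point V).nfix = 1 := by
  rw [← GOrbit.natCard_eq_one_of_isFixed hV]
  exact Nat.card_congr (Equiv.subtypeUnivEquiv fun v g => hV g v)

theorem VSet.nfree_point_of_isFixed (hV : V.IsFixed) : (VSet.point V).nfree = 0 := by
  refine nfree_eq_of_natCard ?_
  rw [nfix_point_of_isFixed hV]
  exact GOrbit.natCard_eq_one_of_isFixed hV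

theorem VSet.nfree_point_of_mem_free (hV : V ∈ Family.free (Cp p)) :
    (VSet.point V).nfree = 1 := by
  refine nfree_eq_of_natCard ?_
  rw [nfix_eq_zero hV, zero_add, mul_one]
  exact GOrbit.natCard_eq_of_mem_free hV

/-- The fixed points of a `V`-set correspond to the orbits isomorphic to `G/G`. -/
theorem VSet.natCard_isFixed_orbit (S : VSet V) :
    Nat.card {o : S.Orb // (S.orbit o).IsFixed} = S.nfix := by
  refine (Nat.card_congr (Equiv.ofBijective (fun x : fixedPoints (Cp p) S.total =>
    (⟨Quotient.mk'' x.1, ?_⟩ : {o : S.Orb // (S.orbit o).IsFixed})) ⟨?_, ?_⟩)).symm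
  · rintro g ⟨y, hy⟩
    obtain ⟨k, rfl⟩ := Quotient.exact (orbitRel.Quotient.mem_orbit.1 hy)
    refine Subtype.ext ?_
    change g • k • x.1 = k • x.1
    rw [x.2 k, x.2 g]
  · rintro ⟨x, hx⟩ ⟨y, hy⟩ h
    obtain ⟨k, hk⟩ := Quotient.exact (congrArg Subtype.val h)
    exact Subtype.ext (by rw [← hk]; exact hy k)
  · rintro ⟨o, ho⟩
    induction o using Quotient.inductionOn with | _ x
    have hx : x ∈ orbitRel.Quotient.orbit (⟦x⟧ : S.Orb) := orbitRel.Quotient.mem_orbit.2 rfl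
    exact ⟨⟨x, fun g => congrArg Subtype.val (ho g ⟨x, hx⟩)⟩, rfl⟩

/-- Each orbit contributes `1` or `p` to the cardinality; the orbits contributing `1` are counted by
`nfix`, which leaves `p` times the number of free ones. -/
theorem VSet.natCard_mem_free_orbit (S : VSet V) :
    Nat.card {o : S.Orb // S.orbit o ∈ Family.free (Cp p)} = S.nfree := by
  classical
  have := Fintype.ofFinite S.Orb
  refine (nfree_eq_of_natCard ?_).symm
  have h1 : Nat.card S.total = ∑ o : S.Orb, Nat.card (S.orbit o) := by
    rw [Nat.card_congr (selfEquivSigmaOrbits' (Cp p) S.total), Nat.card_sigma]; rfl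
  have h2 : ∀ o : S.Orb, Nat.card (S.orbit o) = (if (S.orbit o).IsFixed then 1 else 0) +
      p * if S.orbit o ∈ Family.free (Cp p) then 1 else 0 := fun o => by
    rcases GOrbit.isFixed_or_mem_free (S.orbit o) with h | h
    · rw [if_pos h, if_neg h.not_mem_free, GOrbit.natCard_eq_one_of_isFixed h, mul_zero,
        add_zero]
    · rw [if_pos h, if_neg fun h' => h'.not_mem_free h, GOrbit.natCard_eq_of_mem_free h, mul_one,
        zero_add]
  rw [h1, Finset.sum_congr rfl fun o _ => h2 o, Finset.sum_add_distrib, ← Finset.mul_sum,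
    Finset.sum_boole, Finset.sum_boole, ← S.natCard_isFixed_orbit, Nat.card_eq_fintype_card,
    Nat.card_eq_fintype_card, Fintype.card_subtype, Fintype.card_subtype]
  rfl

theorem VSet.count_res_of_bijective {U : GOrbit (Cp p)} (f : U →[Cp p] V)
    (hf : Function.Bijective f) (S : VSet V) : (S.res f).nfix = S.nfix ∧
      (S.res f).nfree = S.nfree := by
  let e : (S.res f).total →[Cp p] S.total := ⟨fun x => x.1.2, fun _ _ => rfl⟩
  have he : Function.Bijective e := by
    refine ⟨fun x y h => ?_, fun s => ?_⟩
    · have h : x.1.2 = y.1.2 := h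
      exact Subtype.ext (Prod.ext (hf.1 (by rw [x.2, y.2, h])) h)
    · obtain ⟨u, hu⟩ := hf.2 (S.proj s)
      exact ⟨⟨(u, s), hu⟩, rfl⟩
  have h1 : (S.res f).nfix = S.nfix := natCard_fixedPoints_congr e he
  refine ⟨h1, nfree_eq_of_natCard ?_⟩
  rw [Nat.card_congr (Equiv.ofBijective e he), h1, S.natCard_total]

/-- Over a one-point base the pullback is the full product `U × S`: it has `p` times as many points
as `S` and none of them is fixed, so it has as many free orbits as `S` has points. -/
theorem VSet.nfree_res_of_isFixed {U : GOrbit (Cp p)} (f : U →[Cp p] V)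
    (hU : U ∈ Family.free (Cp p)) (hV : V.IsFixed) (S : VSet V) :
    (S.res f).nfree = S.nfix + p * S.nfree := by
  refine nfree_eq_of_natCard ?_
  rw [nfix_eq_zero hU, zero_add, ← S.natCard_total]
  refine Eq.trans ?_ (congrArg (· * _) (GOrbit.natCard_eq_of_mem_free hU))
  refine Eq.trans ?_ (Nat.card_prod _ _)
  exact Nat.card_congr (Equiv.subtypeUnivEquiv fun x => hV.subsingleton.elim _ _)

end Counting

/-! ### Weak indexing systems as pairs of sets of counts -/

/-- The conditions on a set `A` of numbers of orbits over `C_p/e` and a set `B` of pairs (number of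
fixed points, number of free orbits) over `C_p/C_p` to define a `C_p`-weak indexing system. -/
structure Admissible (p : ℕ) (A : ℕ → Prop) (B : ℕ → ℕ → Prop) : Prop where
  res : ∀ {m k}, B m k → A (m + p * k)
  free_one : ∀ {n}, A n → A 1
  fixed_one : ∀ {m k}, B m k → B 1 0
  free_sum : ∀ {ι : Type} [Fintype ι] (a : ι → ℕ), A (Fintype.card ι) → (∀ i, A (a i)) →
    A (∑ i, a i)
  fixed_sum : ∀ {ι κ : Type} [Fintype ι] [Fintype κ] (b c : ι → ℕ) (a : κ → ℕ),
    B (Fintype.card ι) (Fintype.card κ) → (∀ i, B (b i) (c i)) → (∀ j, A (a j)) →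
    B (∑ i, b i) (∑ i, c i + ∑ j, a j)

namespace WIndSys

variable {p : ℕ} [Fact p.Prime]

/-- `n` copies of the point over free orbits lie in `I`. -/
def FreeVal (I : GWIndSys (Cp p)) (n : ℕ) : Prop :=
  ∀ V ∈ Family.free (Cp p), ∀ S : VSet V, S.nfree = n → S ∈ I.sets V trivial

/-- The sets over `C_p/C_p` with `m` fixed points and `k` free orbits lie in `I`. -/
def FixedVal (I : GWIndSys (Cp p)) (m k : ℕ) : Prop :=
  ∀ V : GOrbit (Cp p), V.IsFixed → ∀ S : VSet V, S.nfix = m → S.nfree = k → S ∈ I.sets V trivial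

/-- Restricting along an isomorphism of orbits and then using the classification by counts. Hence
membership in `I` depends only on the type of the orbit and on the counts, and one orbit of each
type suffices as a test. -/
theorem mem_of_count (I : GWIndSys (Cp p)) {U V : GOrbit (Cp p)} (f : U →[Cp p] V)
    (hf : Function.Bijective f) {S : VSet V} {T : VSet U} (h : S ∈ I.sets V trivial)
    (h1 : T.nfix = S.nfix) (h2 : T.nfree = S.nfree) : T ∈ I.sets U trivial := by
  obtain ⟨h3, h4⟩ := VSet.count_res_of_bijective f hf S
  exact I.iso_mem _ (VSet.iso_of_count (h3.trans h1.symm) (h4.trans h2.symm)) (I.res_mem _ f h)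

theorem mem_iff_freeVal (I : GWIndSys (Cp p)) {V : GOrbit (Cp p)} {hV : V ∈ Family.all (Cp p)}
    (hV' : V ∈ Family.free (Cp p)) {S : VSet V} : S ∈ I.sets V hV ↔ I.FreeVal S.nfree := by
  refine ⟨fun h U hU T hT => ?_, fun h => h V hV' S rfl⟩
  obtain ⟨f⟩ := GOrbit.exists_hom_of_mem_free hU V
  exact I.mem_of_count f (GOrbit.hom_bijective_of_mem_free hV' f) h
    (by rw [VSet.nfix_eq_zero hU, VSet.nfix_eq_zero hV']) hT

theorem mem_iff_fixedVal (I : GWIndSys (Cp p)) {V : GOrbit (Cp p)} {hV : V ∈ Family.all (Cp p)}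
    (hV' : V.IsFixed) {S : VSet V} : S ∈ I.sets V hV ↔ I.FixedVal S.nfix S.nfree := by
  refine ⟨fun h U hU T hT hT' => ?_, fun h => h V hV' S rfl rfl⟩
  obtain ⟨f⟩ := GOrbit.exists_hom_of_isFixed U hV'
  exact I.mem_of_count f (GOrbit.hom_bijective_of_isFixed hU f) h hT hT'

theorem exists_vset_of_isFixed {V : GOrbit (Cp p)} (hV : V.IsFixed) (m k : ℕ) :
    ∃ S : VSet V, S.nfix = m ∧ S.nfree = k :=
  ⟨VSet.model V.nonempty.some m k fun _ => hV, VSet.nfix_model _ _ _ _, VSet.nfree_model _ _ _ _⟩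

theorem exists_vset_nfix_eq_zero (V : GOrbit (Cp p)) (n : ℕ) :
    ∃ S : VSet V, S.nfix = 0 ∧ S.nfree = n :=
  ⟨VSet.model V.nonempty.some 0 n fun h => (h.ne rfl).elim, VSet.nfix_model _ _ _ _,
    VSet.nfree_model _ _ _ _⟩

theorem exists_free_vset (n : ℕ) :
    ∃ V : GOrbit (Cp p), V ∈ Family.free (Cp p) ∧ ∃ S : VSet V, S.nfree = n := by
  obtain ⟨S, -, h⟩ := exists_vset_nfix_eq_zero (GOrbit.regular (Cp p)) n
  exact ⟨_, GOrbit.regular_mem_free, S, h⟩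

theorem le_iff_val {I J : GWIndSys (Cp p)} : I ≤ J ↔
    (∀ n, I.FreeVal n → J.FreeVal n) ∧ ∀ m k, I.FixedVal m k → J.FixedVal m k := by
  refine ⟨fun h => ⟨fun n hn V hV S hS => h V _ (hn V hV S hS),
    fun m k hm V hV S hS hS' => h V _ (hm V hV S hS hS')⟩, fun h V _ S hS => ?_⟩
  rcases GOrbit.isFixed_or_mem_free V with hV | hV
  · rw [mem_iff_fixedVal _ hV] at hS ⊢
    exact h.2 _ _ hS
  · rw [mem_iff_freeVal _ hV] at hS ⊢
    exact h.1 _ hS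

theorem eq_iff_val {I J : GWIndSys (Cp p)} : I = J ↔
    (∀ n, I.FreeVal n ↔ J.FreeVal n) ∧ ∀ m k, I.FixedVal m k ↔ J.FixedVal m k := by
  refine ⟨fun h => h ▸ ⟨fun _ => Iff.rfl, fun _ _ => Iff.rfl⟩, fun h => ?_⟩
  exact le_antisymm (le_iff_val.2 ⟨fun n => (h.1 n).1, fun m k => (h.2 m k).1⟩)
    (le_iff_val.2 ⟨fun n => (h.1 n).2, fun m k => (h.2 m k).2⟩)

/-- Each condition is one axiom read off over `C_p/e` or `C_p/C_p`. In an indexed coproduct over a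
fixed orbit, the fixed points of `S` are indexed by `ι` and receive sets with counts `(b i, c i)`,
while its free orbits are indexed by `κ` and receive `a j` free orbits each. -/
theorem admissible_val (I : GWIndSys (Cp p)) : Admissible p I.FreeVal I.FixedVal where
  res {m k} h := by
    obtain ⟨S, hm, hk⟩ := exists_vset_of_isFixed (p := p) GOrbit.isFixed_pt m k
    subst hm hk
    rw [← I.mem_iff_fixedVal (hV := trivial) GOrbit.isFixed_pt] at h
    obtain ⟨f⟩ := GOrbit.exists_hom_of_isFixed (GOrbit.regular (Cp p)) GOrbit.isFixed_pt
    have := I.res_mem _ f h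
    rwa [I.mem_iff_freeVal GOrbit.regular_mem_free,
      VSet.nfree_res_of_isFixed f GOrbit.regular_mem_free GOrbit.isFixed_pt] at this
  free_one {n} h := by
    obtain ⟨V, hV, S, rfl⟩ := exists_free_vset (p := p) n
    have := I.point_mem (V := V) trivial ⟨S, (I.mem_iff_freeVal hV).2 h⟩
    rwa [I.mem_iff_freeVal (hV := trivial) hV, VSet.nfree_point_of_mem_free hV] at this
  fixed_one {m k} h := by
    have hV : (GOrbit.pt (Cp p)).IsFixed := GOrbit.isFixed_pt
    obtain ⟨S, rfl, rfl⟩ := exists_vset_of_isFixed hV m k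
    have := I.point_mem (V := GOrbit.pt (Cp p)) trivial ⟨S, (I.mem_iff_fixedVal hV).2 h⟩
    rwa [I.mem_iff_fixedVal (hV := trivial) hV, VSet.nfix_point_of_isFixed hV,
      VSet.nfree_point_of_isFixed hV] at this
  free_sum {ι _} a h ha := by
    obtain ⟨V, hV, S, hS⟩ := exists_free_vset (p := p) (Fintype.card ι)
    rw [← hS, ← I.mem_iff_freeVal (hV := trivial) hV] at h
    have ho : ∀ o : S.Orb, S.orbit o ∈ Family.free (Cp p) :=
      fun o => (Family.free (Cp p)).closed (S.orbitMap o) hV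
    let _ := Fintype.ofFinite S.Orb
    -- Over a free orbit all orbits of `S` are free, so there are `nfree` of them and they can be
    -- relabelled by `ι`.
    obtain ⟨e⟩ : Nonempty (S.Orb ≃ ι) := by
      rw [← Fintype.card_eq, ← hS, ← S.natCard_mem_free_orbit,
        Nat.card_congr (Equiv.subtypeUnivEquiv ho), Nat.card_eq_fintype_card]
    choose T hT using fun o : S.Orb => exists_vset_nfix_eq_zero (S.orbit o) (a (e o))
    have := I.coprod_mem (S := S) (T := T) trivial h fun o => by
      rw [I.mem_iff_freeVal (ho o), (hT o).2]
      exact ha _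
    rw [I.mem_iff_freeVal (hV := trivial) hV, VSet.nfree_indexedCoprod] at this
    rwa [Finset.sum_congr rfl fun o _ => (hT o).2, e.sum_comp a] at this
  fixed_sum {ι κ _ _} b c a h hb ha := by
    classical
    have hV : (GOrbit.pt (Cp p)).IsFixed := GOrbit.isFixed_pt
    obtain ⟨S, hm, hk⟩ := exists_vset_of_isFixed hV (Fintype.card ι) (Fintype.card κ)
    rw [← hm, ← hk, ← I.mem_iff_fixedVal (hV := trivial) hV] at h
    let _ := Fintype.ofFinite S.Orb
    obtain ⟨e⟩ : Nonempty ({o : S.Orb // (S.orbit o).IsFixed} ≃ ι) := by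
      rw [← Fintype.card_eq, ← hm, ← S.natCard_isFixed_orbit, Nat.card_eq_fintype_card]
    obtain ⟨f⟩ : Nonempty ({o : S.Orb // ¬ (S.orbit o).IsFixed} ≃ κ) := by
      rw [← Fintype.card_eq, ← hk, ← S.natCard_mem_free_orbit, ← Nat.card_eq_fintype_card]
      exact Nat.card_congr (Equiv.subtypeEquivRight fun o =>
        ⟨(GOrbit.isFixed_or_mem_free _).resolve_left, fun h h' => h'.not_mem_free h⟩)
    -- A set over a free orbit has no fixed points, hence the `0` in the first count.
    have hT : ∀ o : S.Orb, ∃ T : VSet (S.orbit o),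
        T.nfix = (if h : (S.orbit o).IsFixed then b (e ⟨o, h⟩) else 0) ∧
        T.nfree = if h : (S.orbit o).IsFixed then c (e ⟨o, h⟩) else a (f ⟨o, h⟩) := fun o => by
      by_cases ho : (S.orbit o).IsFixed
      · simpa only [dif_pos ho] using exists_vset_of_isFixed ho _ _
      · simpa only [dif_neg ho] using
          exists_vset_nfix_eq_zero (S.orbit o) _
    choose T hT1 hT2 using hT
    have := I.coprod_mem (S := S) (T := T) trivial h fun o => by
      by_cases ho : (S.orbit o).IsFixed
      · rw [I.mem_iff_fixedVal ho, hT1, hT2, dif_pos ho, dif_pos ho]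
        exact hb _
      · rw [I.mem_iff_freeVal ((GOrbit.isFixed_or_mem_free _).resolve_left ho), hT2, dif_neg ho]
        exact ha _
    rw [I.mem_iff_fixedVal (hV := trivial) hV, VSet.nfree_indexedCoprod,
      VSet.nfix_indexedCoprod] at this
    rw [← Fintype.sum_subtype_add_sum_subtype (fun o : S.Orb => (S.orbit o).IsFixed),
      ← Fintype.sum_subtype_add_sum_subtype (fun o : S.Orb => (S.orbit o).IsFixed),
      Finset.sum_congr rfl fun (o : {o : S.Orb // (S.orbit o).IsFixed}) _ =>
        (hT1 o).trans (dif_pos o.2),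
      Finset.sum_congr rfl fun (o : {o : S.Orb // (S.orbit o).IsFixed}) _ =>
        (hT2 o).trans (dif_pos o.2),
      Finset.sum_congr rfl fun (o : {o : S.Orb // ¬ (S.orbit o).IsFixed}) _ =>
        (hT2 o).trans (dif_neg o.2),
      Finset.sum_eq_zero fun (o : {o : S.Orb // ¬ (S.orbit o).IsFixed}) _ =>
        (hT1 o).trans (dif_neg o.2), add_zero] at this
    simp only [Subtype.coe_eta] at this
    rwa [e.sum_comp b, e.sum_comp c, f.sum_comp a] at this

/-- The `C_p`-weak indexing system with prescribed counts. -/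
def ofCounts {A : ℕ → Prop} {B : ℕ → ℕ → Prop} (h : Admissible p A B) : GWIndSys (Cp p) where
  sets V _ := {S | (V ∈ Family.free (Cp p) → A S.nfree) ∧ (V.IsFixed → B S.nfix S.nfree)}
  iso_mem _ S T e hS := by
    rwa [Set.mem_ofPred_eq, ← VSet.nfree_eq_of_iso e, ← VSet.nfix_eq_of_iso e]
  res_mem {U V} _ f S hS := by
    -- Counts change only when `V` is fixed and `U` is free, where `h.res` applies; a fixed `U` over
    -- a free `V` is excluded because the family is closed.
    rcases GOrbit.isFixed_or_mem_free V with hV | hV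
    · rcases GOrbit.isFixed_or_mem_free U with hU | hU
      · obtain ⟨h1, h2⟩ := VSet.count_res_of_bijective f (GOrbit.hom_bijective_of_isFixed hU f) S
        exact ⟨fun h => (hU.not_mem_free h).elim, fun _ => h1.symm ▸ h2.symm ▸ hS.2 hV⟩
      · refine ⟨fun _ => ?_, fun h => (h.not_mem_free hU).elim⟩
        rw [VSet.nfree_res_of_isFixed f hU hV]
        exact h.res (hS.2 hV)
    · obtain ⟨-, h2⟩ := VSet.count_res_of_bijective f (GOrbit.hom_bijective_of_mem_free hV f) S
      exact ⟨fun _ => h2.symm ▸ hS.1 hV,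
        fun h => (h.not_mem_free ((Family.free (Cp p)).closed f hV)).elim⟩
  point_mem {V} _ := by
    rintro ⟨S, h1, h2⟩
    refine ⟨fun hV => ?_, fun hV => ?_⟩
    · rw [VSet.nfree_point_of_mem_free hV]
      exact h.free_one (h1 hV)
    · rw [VSet.nfree_point_of_isFixed hV, VSet.nfix_point_of_isFixed hV]
      exact h.fixed_one (h2 hV)
  coprod_mem {V} _ S T hS hT := by
    classical
    let _ := Fintype.ofFinite S.Orb
    refine ⟨fun hV => ?_, fun hV => ?_⟩
    · have ho : ∀ o : S.Orb, S.orbit o ∈ Family.free (Cp p) :=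
        fun o => (Family.free (Cp p)).closed (S.orbitMap o) hV
      rw [VSet.nfree_indexedCoprod]
      refine h.free_sum _ ?_ fun o => (hT o).1 (ho o)
      rw [← Nat.card_eq_fintype_card, ← Nat.card_congr (Equiv.subtypeUnivEquiv ho),
        S.natCard_mem_free_orbit]
      exact hS.1 hV
    · have hfree : ∀ o : {o : S.Orb // ¬ (S.orbit o).IsFixed},
          S.orbit o.1 ∈ Family.free (Cp p) :=
        fun o => (GOrbit.isFixed_or_mem_free _).resolve_left o.2
      rw [VSet.nfree_indexedCoprod, VSet.nfix_indexedCoprod,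
        ← Fintype.sum_subtype_add_sum_subtype (fun o : S.Orb => (S.orbit o).IsFixed),
        ← Fintype.sum_subtype_add_sum_subtype (fun o : S.Orb => (S.orbit o).IsFixed),
        Finset.sum_eq_zero (fun o _ => VSet.nfix_eq_zero (hfree o) (T o.1)), add_zero]
      refine h.fixed_sum _ _ _ ?_ (fun o => (hT o.1).2 o.2) fun o => (hT o.1).1 (hfree o)
      rw [← Nat.card_eq_fintype_card, ← Nat.card_eq_fintype_card, S.natCard_isFixed_orbit,
        Nat.card_congr (Equiv.subtypeEquivRight (q := fun o => S.orbit o ∈ Family.free (Cp p))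
          fun o => ⟨(GOrbit.isFixed_or_mem_free _).resolve_left, fun h h' => h'.not_mem_free h⟩),
        S.natCard_mem_free_orbit]
      exact hS.2 hV

section Val

variable (I : GWIndSys (Cp p)) {A : ℕ → Prop} {B : ℕ → ℕ → Prop}

theorem freeVal_iff (h : ∀ V ∈ Family.free (Cp p), ∀ (S : VSet V),
    S ∈ I.sets V trivial ↔ A S.nfree) (n : ℕ) : I.FreeVal n ↔ A n := by
  obtain ⟨V, hV, S, rfl⟩ := exists_free_vset (p := p) n
  rw [← I.mem_iff_freeVal (hV := trivial) hV, h V hV]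

theorem fixedVal_iff (h : ∀ V : GOrbit (Cp p), V.IsFixed → ∀ (S : VSet V),
    S ∈ I.sets V trivial ↔ B S.nfix S.nfree) (m k : ℕ) : I.FixedVal m k ↔ B m k := by
  obtain ⟨S, rfl, rfl⟩ := exists_vset_of_isFixed (p := p) GOrbit.isFixed_pt m k
  rw [← I.mem_iff_fixedVal (hV := trivial) GOrbit.isFixed_pt, h _ GOrbit.isFixed_pt]

end Val

variable {A : ℕ → Prop} {B : ℕ → ℕ → Prop}

theorem freeVal_ofCounts (h : Admissible p A B) (n : ℕ) : (ofCounts h).FreeVal n ↔ A n :=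
  freeVal_iff (ofCounts h) (fun _ hV _ => ⟨fun hS => hS.1 hV,
    fun hS => ⟨fun _ => hS, fun hV' => (hV'.not_mem_free hV).elim⟩⟩) n

theorem fixedVal_ofCounts (h : Admissible p A B) (m k : ℕ) :
    (ofCounts h).FixedVal m k ↔ B m k :=
  fixedVal_iff (ofCounts h) (fun _ hV _ => ⟨fun hS => hS.2 hV,
    fun hS => ⟨fun hV' => (hV.not_mem_free hV').elim, fun _ => hS⟩⟩) m k

end WIndSys

/-! ### Classification of admissible counts -/

/-- Closure of counts under summands, apart from those of the point. -/
structure SummandClosed (A : ℕ → Prop) (B : ℕ → ℕ → Prop) : Prop where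
  free : ∀ {n n'}, n + n' ≠ 1 → A (n + n') → A n ∧ A n'
  fixed : ∀ {m k m' k'}, ¬ (m + m' = 1 ∧ k + k' = 0) → B (m + m') (k + k') → B m k ∧ B m' k'

/-- Downward closure. The count of the point has to be excluded: containing `*_V` need not give
`∅_V`. -/
theorem SummandClosed.free_le {A : ℕ → Prop} {B : ℕ → ℕ → Prop} (hs : SummandClosed A B)
    {n n' : ℕ} (h : A n) (h1 : n ≠ 1) (hn : n' ≤ n) : A n' := by
  obtain ⟨d, rfl⟩ := Nat.exists_eq_add_of_le hn
  exact (hs.free h1 h).1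

theorem SummandClosed.fixed_le {A : ℕ → Prop} {B : ℕ → ℕ → Prop} (hs : SummandClosed A B)
    {m k m' k' : ℕ} (h : B m k) (h1 : ¬ (m = 1 ∧ k = 0)) (hm : m' ≤ m) (hk : k' ≤ k) :
    B m' k' := by
  obtain ⟨d, rfl⟩ := Nat.exists_eq_add_of_le hm
  obtain ⟨d', rfl⟩ := Nat.exists_eq_add_of_le hk
  exact (hs.fixed h1 h).1

namespace Admissible

variable {p : ℕ} {A : ℕ → Prop} {B : ℕ → ℕ → Prop}

/-- The large element `N` serves as an indexing set of size at least two: two slots add `1` to `n`,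
and the remaining slots are filled with empty sets. -/
theorem free_all (h : Admissible p A B) (h0 : A 0) {N : ℕ} (hN : 2 ≤ N) (hA : A N) (n : ℕ) :
    A n := by
  obtain ⟨M, rfl⟩ := Nat.exists_eq_add_of_le' hN
  induction n with
  | zero => exact h0
  | succ n ih =>
    have := h.free_sum (ι := Fin (M + 2)) (Fin.cons n (Fin.cons 1 fun _ => 0)) (by simpa using hA)
      (Fin.cases ih (Fin.cases (h.free_one h0) fun _ => h0))
    simpa [Fin.sum_univ_succ] using this

/-- Index over a single free orbit and substitute `k` copies of the point for it. -/
theorem fixed_free_all (h : Admissible p A B) (hA : ∀ n, A n) (h01 : B 0 1) (k : ℕ) : B 0 k := by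
  simpa using h.fixed_sum (ι := Fin 0) (κ := Fin 1) (fun _ => 0) (fun _ => 0) (fun _ => k)
    (by simpa using h01) (fun i => i.elim0) fun _ => hA k

theorem fixed_one_all (h : Admissible p A B) (hA : ∀ n, A n) (h11 : B 1 1) (k : ℕ) : B 1 k := by
  simpa using h.fixed_sum (ι := Fin 1) (κ := Fin 1) (fun _ => 1) (fun _ => 0) (fun _ => k)
    (by simpa using h11) (fun _ => h.fixed_one h11) fun _ => hA k

/-- Two fixed points index a binary coproduct, so `(2,0)` makes `B` closed under addition. -/
theorem fixed_add (h : Admissible p A B) (h20 : B 2 0) {m k m' k' : ℕ} (hm : B m k)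
    (hm' : B m' k') : B (m + m') (k + k') := by
  simpa using h.fixed_sum (ι := Fin 2) (κ := Fin 0) ![m, m'] ![k, k'] (fun _ => 0)
    (by simpa using h20) (Fin.forall_fin_two.2 ⟨hm, hm'⟩) (fun i => i.elim0)

theorem fixed_copies_all (h : Admissible p A B) (h20 : B 2 0) (h00 : B 0 0) (m : ℕ) : B m 0 := by
  induction m with
  | zero => exact h00
  | succ m ih => exact h.fixed_add h20 ih (h.fixed_one h00)

/-- An element at least `2` gives `0` by summand closure and then everything by `free_all`.
Otherwise `A` lies in `{0, 1}`, and it contains `1` as soon as it is nonempty. -/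
theorem classify_free (h : Admissible p A B) (hs : SummandClosed A B) :
    (∀ n, ¬ A n) ∨ (∀ n, A n ↔ n = 1) ∨ (∀ n, A n ↔ n ≤ 1) ∨ ∀ n, A n := by
  by_cases h2 : ∃ n, 2 ≤ n ∧ A n
  · obtain ⟨n, hn, hA⟩ := h2
    exact Or.inr (Or.inr (Or.inr (h.free_all (hs.free_le hA (by lia) (Nat.zero_le n)) hn hA)))
  have hle : ∀ n, A n → n = 0 ∨ n = 1 := fun n hn => by
    by_contra hn'
    exact h2 ⟨n, by lia, hn⟩
  by_cases h1 : A 1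
  · by_cases h0 : A 0
    · refine Or.inr (Or.inr (Or.inl fun n => ⟨fun hn => by have := hle n hn; lia, fun hn => ?_⟩))
      obtain rfl | rfl : n = 0 ∨ n = 1 := by lia
      exacts [h0, h1]
    · refine Or.inr (Or.inl fun n => ⟨fun hn => ?_, fun hn => hn ▸ h1⟩)
      exact (hle n hn).resolve_left fun h => h0 (h ▸ hn)
  · exact Or.inl fun n hn => h1 (h.free_one hn)

end Admissible

/-! ### The counts of the vertices of the Hasse diagram -/

/-- The numbers of free orbits at a vertex. -/
def Vertex.freeTable : Vertex → ℕ → Prop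
  | empty, _ => False
  | extTriv, n | triv, n => n = 1
  | extZero, n | zeroE, n | zero, n => n ≤ 1
  | extInfty, _ | trivJoinExtInfty, _ | inftyE, _ | infty, _ | overline, _ | lam, _
  | complete, _ => True

/-- The numbers of fixed points and free orbits at a vertex. -/
def Vertex.fixedTable : Vertex → ℕ → ℕ → Prop
  | empty, _, _ | extTriv, _, _ | extZero, _, _ | extInfty, _, _ => False
  | triv, m, k | zeroE, m, k | trivJoinExtInfty, m, k => m = 1 ∧ k = 0
  | zero, m, k | inftyE, m, k => m ≤ 1 ∧ k = 0
  | infty, _, k => k = 0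
  | overline, m, k => (m = 1 ∧ k = 0) ∨ m = 0
  | lam, m, _ => m ≤ 1
  | complete, _, _ => True

/-- The admissible counts that are closed under summands are those of the 13 vertices. -/
theorem Admissible.exists_vertex {p : ℕ} (hp : 2 ≤ p) {A : ℕ → Prop} {B : ℕ → ℕ → Prop}
    (h : Admissible p A B) (hs : SummandClosed A B) :
    ∃ x : Vertex, (∀ n, A n ↔ x.freeTable n) ∧ ∀ m k, B m k ↔ x.fixedTable m k := by
  have hA0 : B 0 0 → A 0 := fun h0 => by simpa using h.res h0
  by_cases h01 : B 0 1
  · have h00 : B 0 0 := hs.fixed_le h01 (by simp) le_rfl (by simp)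
    -- A free orbit over `C_p/C_p` restricts to `p ≥ 2` copies of the point.
    have hA : ∀ n, A n := h.free_all (hA0 h00) hp (by simpa using h.res h01)
    have h0 := h.fixed_free_all hA h01
    by_cases h20 : B 2 0
    · refine ⟨.complete, fun n => iff_true_intro (hA n), fun m k => iff_true_intro ?_⟩
      simpa using h.fixed_add h20 (h.fixed_copies_all h20 h00 m) (h0 k)
    have hm : ∀ m k, B m k → m = 0 ∨ m = 1 := fun m k hB => by
      by_contra hm
      exact h20 (hs.fixed_le hB (by lia) (by lia) (by lia))
    by_cases h11 : B 1 1
    · have h1 := h.fixed_one_all hA h11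
      refine ⟨.lam, fun n => iff_true_intro (hA n), fun m k => ⟨fun hB => ?_, fun hm => ?_⟩⟩
      · have := hm m k hB
        change m ≤ 1
        lia
      · have hm : m ≤ 1 := hm
        obtain rfl | rfl : m = 0 ∨ m = 1 := by lia
        exacts [h0 k, h1 k]
    · refine ⟨.overline, fun n => iff_true_intro (hA n), fun m k => ⟨fun hB => ?_, ?_⟩⟩
      · rcases hm m k hB with rfl | rfl
        · exact Or.inr rfl
        · refine Or.inl ⟨rfl, ?_⟩
          by_contra hk
          exact h11 (hs.fixed_le hB (by lia) le_rfl (by lia))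
      · rintro (⟨rfl, rfl⟩ | rfl)
        exacts [h.fixed_one h00, h0 k]
  -- Any pair with `k > 0` dominates `(0,1)`, which is now excluded.
  have hk : ∀ m k, B m k → k = 0 := fun m k hB => by
    by_contra hk
    exact h01 (hs.fixed_le hB (by lia) (by lia) (by lia))
  by_cases h20 : B 2 0
  · have h00 : B 0 0 := hs.fixed_le h20 (by simp) (by simp) le_rfl
    have hA : ∀ n, A n := h.free_all (hA0 h00) le_rfl (by simpa using h.res h20)
    refine ⟨.infty, fun n => iff_true_intro (hA n), fun m k => ⟨hk m k, ?_⟩⟩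
    rintro rfl
    exact h.fixed_copies_all h20 h00 m
  have hm : ∀ m k, B m k → m = 0 ∨ m = 1 := fun m k hB => by
    by_contra hm
    exact h20 (hs.fixed_le hB (by lia) (by lia) (by lia))
  have hclass := h.classify_free hs
  by_cases h00 : B 0 0
  · have hB : ∀ m k, B m k ↔ m ≤ 1 ∧ k = 0 := fun m k => by
      refine ⟨fun hB => ⟨by have := hm m k hB; lia, hk m k hB⟩, ?_⟩
      rintro ⟨hm, rfl⟩
      obtain rfl | rfl : m = 0 ∨ m = 1 := by lia
      exacts [h00, h.fixed_one h00]
    rcases hclass with hA | hA | hA | hA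
    · exact (hA _ (hA0 h00)).elim
    · exact absurd ((hA _).1 (hA0 h00)) (by simp)
    · exact ⟨.zero, hA, hB⟩
    · exact ⟨.inftyE, fun n => iff_true_intro (hA n), hB⟩
  by_cases h10 : B 1 0
  · have hB : ∀ m k, B m k ↔ m = 1 ∧ k = 0 := fun m k => by
      refine ⟨fun hB => ⟨(hm m k hB).resolve_left ?_, hk m k hB⟩, ?_⟩
      · rintro rfl
        obtain rfl := hk _ k hB
        exact h00 hB
      · rintro ⟨rfl, rfl⟩
        exact h10
    rcases hclass with hA | hA | hA | hA
    · exact (hA _ (h.res h10)).elim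
    · exact ⟨.triv, hA, hB⟩
    · exact ⟨.zeroE, hA, hB⟩
    · exact ⟨.trivJoinExtInfty, fun n => iff_true_intro (hA n), hB⟩
  · have hB : ∀ m k, B m k ↔ False := fun m k => iff_false_intro fun hB => h10 (h.fixed_one hB)
    rcases hclass with hA | hA | hA | hA
    · exact ⟨.empty, fun n => iff_false_intro (hA n), hB⟩
    · exact ⟨.extTriv, hA, hB⟩
    · exact ⟨.extZero, hA, hB⟩
    · exact ⟨.extInfty, fun n => iff_true_intro (hA n), hB⟩

/-! ### Admissibility of the counts at vertices defined by joins -/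

/-- Over `C_p/C_p` the only available indexing set is one fixed point carrying the point, so the
coproduct is again the point and only the conditions on `A` remain. -/
theorem admissible_of_fixed_eq_point {p : ℕ} {A : ℕ → Prop} (h1 : A 1)
    (hA : ∀ {ι : Type} [Fintype ι] (a : ι → ℕ), A (Fintype.card ι) → (∀ i, A (a i)) →
      A (∑ i, a i)) : Admissible p A (fun m k => m = 1 ∧ k = 0) where
  res := by rintro m k ⟨rfl, rfl⟩; exact h1
  free_one _ := h1
  fixed_one _ := ⟨rfl, rfl⟩
  free_sum := hA
  fixed_sum {ι κ} _ _ b c a h hb _ := by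
    have := Fintype.card_eq_zero_iff.1 h.2
    rw [Finset.sum_congr rfl fun i _ => (hb i).1, Finset.sum_congr rfl fun i _ => (hb i).2]
    simpa using h.1

theorem admissible_zeroE {p : ℕ} :
    Admissible p Vertex.zeroE.freeTable Vertex.zeroE.fixedTable :=
  admissible_of_fixed_eq_point le_rfl fun a h ha =>
    (Finset.sum_le_card_nsmul _ a 1 fun i _ => ha i).trans (by simpa [Vertex.freeTable] using h)

theorem admissible_trivJoinExtInfty {p : ℕ} :
    Admissible p Vertex.trivJoinExtInfty.freeTable Vertex.trivJoinExtInfty.fixedTable :=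
  admissible_of_fixed_eq_point trivial fun _ _ _ => trivial

theorem admissible_inftyE {p : ℕ} :
    Admissible p Vertex.inftyE.freeTable Vertex.inftyE.fixedTable where
  res _ := trivial
  free_one _ := trivial
  fixed_one _ := ⟨le_rfl, rfl⟩
  free_sum _ _ _ := trivial
  fixed_sum {ι κ} _ _ b c a h hb _ := by
    have := Fintype.card_eq_zero_iff.1 h.2
    refine ⟨(Finset.sum_le_card_nsmul _ b 1 fun i _ => (hb i).1).trans (by simpa using h.1), ?_⟩
    rw [Finset.sum_congr rfl fun i _ => (hb i).2]
    simp

/-- A coproduct indexed by one fixed point is its single summand; one indexed by free orbits alone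
has no fixed points. -/
theorem admissible_overline {p : ℕ} :
    Admissible p Vertex.overline.freeTable Vertex.overline.fixedTable where
  res _ := trivial
  free_one _ := trivial
  fixed_one _ := Or.inl ⟨rfl, rfl⟩
  free_sum _ _ _ := trivial
  fixed_sum {ι κ} _ _ b c a h hb _ := by
    rcases h with ⟨h, h'⟩ | h
    · have := Fintype.card_eq_zero_iff.1 h'
      obtain ⟨i, hi⟩ := Fintype.card_eq_one_iff.1 h
      have : Unique ι := ⟨⟨i⟩, hi⟩
      simpa using hb default
    · have := Fintype.card_eq_zero_iff.1 h
      exact Or.inr (by simp)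

/-! ### Embeddings into an irreducible orthogonal representation -/

section Rep

variable {p : ℕ} [Fact p.Prime] {L : Type*} [NormedAddCommGroup L] [InnerProductSpace ℝ L]
  {ρ : Representation ℝ (Cp p) L}

/-- The invariants form a subrepresentation, which by irreducibility is zero or everything; the
latter would make the action trivial. -/
theorem eq_zero_of_invariant {G : Type*} [CommGroup G] {k M : Type*} [Field k] [AddCommGroup M]
    [Module k M] {ρ : Representation k G M} (hirr : ρ.IsIrreducible)
    (hnontriv : ∃ g v, ρ g v ≠ v) {v : M} (hv : ∀ g, ρ g v = v) : v = 0 := by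
  let W : Subrepresentation ρ := ⟨ρ.invariants, fun g w hw => by
    rw [Representation.mem_invariants] at hw ⊢
    intro h
    rw [hw g, hw h]⟩
  have hvW : v ∈ W.toSubmodule := hv
  rcases hirr.eq_bot_or_eq_top W with h | h
  · rw [h] at hvW
    exact hvW
  · obtain ⟨g, w, hw⟩ := hnontriv
    have hwW : w ∈ W.toSubmodule := by rw [h]; trivial
    exact (hw (hwW g)).elim

/-- The stabilizer of `v` is trivial or everything by primality; in the second case `v` would be
invariant, hence zero. -/
theorem eq_one_of_apply_eq_self (hirr : ρ.IsIrreducible) (hnontriv : ∃ g v, ρ g v ≠ v) {v : L}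
    (hv : v ≠ 0) {g : Cp p} (hg : ρ g v = v) : g = 1 := by
  have : Fact (Nat.card (Cp p)).Prime := ⟨by rw [Cp.natCard]; exact Fact.out⟩
  let H : Subgroup (Cp p) :=
    { carrier := {g | ρ g v = v}
      one_mem' := by simp
      mul_mem' := fun {a b} ha hb => by
        change ρ (a * b) v = v
        rw [map_mul, Module.End.mul_apply, show ρ b v = v from hb, show ρ a v = v from ha]
      inv_mem' := fun {a} ha => by
        change ρ a⁻¹ v = v
        conv_lhs => rw [← show ρ a v = v from ha]
        rw [← Module.End.mul_apply, ← map_mul, inv_mul_cancel, map_one, Module.End.one_apply] }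
  have hgH : g ∈ H := hg
  rcases H.eq_bot_or_eq_top_of_prime_card with h | h
  · rwa [h, Subgroup.mem_bot] at hgH
  · refine (hv (eq_zero_of_invariant hirr hnontriv fun k => ?_)).elim
    have : k ∈ H := h ▸ Subgroup.mem_top k
    exact this

/-- A fixed point has to go to an invariant vector, that is to `0`, so two fixed points over the
same base point collide. Conversely, the fixed point is sent to `0` and the free orbits go to copies
of the orbit of one nonzero vector, scaled by distinct positive factors. Norms tell the orbits
apart, and trivial stabilizers give injectivity on each of them. -/
theorem WIndSys.mem_ofRep_iff (horth : ∀ g v, ‖ρ g v‖ = ‖v‖) (hirr : ρ.IsIrreducible)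
    (hnontriv : ∃ g v, ρ g v ≠ v) {F : Family (Cp p)} {V : GOrbit (Cp p)} (hV : V ∈ F)
    (S : VSet V) : S ∈ (WIndSys.ofRep F ρ).sets V hV ↔ S.nfix ≤ 1 := by
  have hfixV : ∀ x ∈ fixedPoints (Cp p) S.total, V.IsFixed := fun x hx => by
    refine (GOrbit.isFixed_or_mem_free V).resolve_right fun h => ?_
    have := VSet.nfix_eq_zero h S
    rw [VSet.nfix, Finite.card_eq_zero_iff] at this
    exact this.false ⟨x, hx⟩
  refine (VSet.embeds_iff ρ).trans ⟨?_, fun hS => ?_⟩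
  · rintro ⟨ψ, hψ, hi⟩
    have hz : ∀ x ∈ fixedPoints (Cp p) S.total, ψ x = 0 := fun x hx =>
      eq_zero_of_invariant hirr hnontriv fun g => by rw [← hψ, hx g]
    rw [VSet.nfix, Finite.card_le_one_iff_subsingleton]
    exact ⟨fun x y => Subtype.ext (hi _ _ ((hfixV x.1 x.2).subsingleton.elim _ _)
      (by rw [hz _ x.2, hz _ y.2]))⟩
  · obtain ⟨v, hv⟩ : ∃ v : L, v ≠ 0 := by
      obtain ⟨g, v, hv⟩ := hnontriv
      exact ⟨v, fun h => hv (by rw [h, map_zero])⟩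
    have hfree : ∀ {g k : Cp p}, ρ g v = ρ k v → g = k := fun {g k} h => by
      have : ρ (k⁻¹ * g) v = v := by
        rw [map_mul, Module.End.mul_apply, h, ← Module.End.mul_apply, ← map_mul, inv_mul_cancel,
          map_one, Module.End.one_apply]
      exact (inv_mul_eq_one.1 (eq_one_of_apply_eq_self hirr hnontriv hv this)).symm
    obtain ⟨n, ⟨c⟩⟩ := Finite.exists_equiv_fin S.Orb
    have hrep : ∀ x : S.total, ∃ g : Cp p, g • Quotient.out (Quotient.mk'' x : S.Orb) = x :=
      fun x => by
        obtain ⟨g, hg⟩ := Quotient.exact (Quotient.out_eq' (Quotient.mk'' x : S.Orb))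
        exact ⟨g⁻¹, by rw [inv_smul_eq_iff]; exact hg.symm⟩
    choose t ht using hrep
    have hmk : ∀ (g : Cp p) (x : S.total), (Quotient.mk'' (g • x) : S.Orb) = Quotient.mk'' x :=
      fun g x => Quotient.sound ⟨g, rfl⟩
    have hsmul : ∀ (g : Cp p) (x : S.total), g • x ∈ fixedPoints (Cp p) S.total ↔
        x ∈ fixedPoints (Cp p) S.total := fun g x => by
      refine ⟨fun hx => ?_, fun hx => by rwa [hx g]⟩
      have := hx g⁻¹
      rw [inv_smul_smul] at this
      rwa [← this] at hx
    -- The scale numbers the orbit of `x`; the shift by one keeps it nonzero.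
    let a : S.total → ℝ := fun x => (c (Quotient.mk'' x) : ℕ) + 1
    have ha : ∀ x, 0 < a x := fun x => by positivity
    classical
    refine ⟨fun x => if x ∈ fixedPoints (Cp p) S.total then 0 else a x • ρ (t x) v,
      fun g x => ?_, fun x y hxy hψ => ?_⟩
    · simp only [hsmul]
      split_ifs with hx
      · rw [map_zero]
      · have h1 : a (g • x) = a x := by simp only [a, hmk]
        -- Off the fixed points the element carrying the representative to `x` is unique, so the
        -- choice `t` is automatically equivariant.
        have h2 : t (g • x) = g * t x := by
          have h3 : t (g • x) • Quotient.out (Quotient.mk'' x : S.Orb) = g • x := by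
            rw [← hmk g x]; exact ht _
          have h4 : (g * t x) • Quotient.out (Quotient.mk'' x : S.Orb) = g • x := by
            rw [mul_smul, ht]
          have hout : Quotient.out (Quotient.mk'' x : S.Orb) ∉ fixedPoints (Cp p) S.total := by
            rwa [← hsmul (t x), ht]
          have := smul_eq_self_imp_eq_one hout (g := (g * t x)⁻¹ * t (g • x))
            (by rw [mul_smul, h3, inv_smul_eq_iff, h4])
          exact (inv_mul_eq_one.1 this).symm
        rw [h1, h2, map_mul, Module.End.mul_apply, map_smul]
    · have hnorm : ∀ x, ‖a x • ρ (t x) v‖ = a x * ‖v‖ := fun x => by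
        rw [norm_smul, horth, Real.norm_of_nonneg (ha x).le]
      have hne : ∀ x, a x • ρ (t x) v ≠ 0 := fun x => by
        rw [← norm_pos_iff, hnorm]
        exact mul_pos (ha x) (norm_pos_iff.2 hv)
      simp only at hψ
      split_ifs at hψ with hx hy hy
      · rw [VSet.nfix, Finite.card_le_one_iff_subsingleton] at hS
        exact congrArg Subtype.val (hS.elim ⟨x, hx⟩ ⟨y, hy⟩)
      · exact (hne _ hψ.symm).elim
      · exact (hne _ hψ).elim
      · have hax : a x = a y := by
          have := congrArg norm hψ
          rw [hnorm, hnorm] at this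
          exact mul_right_cancel₀ (norm_ne_zero_iff.2 hv) this
        have ho : (Quotient.mk'' x : S.Orb) = Quotient.mk'' y := by
          refine c.injective (Fin.ext ?_)
          exact_mod_cast add_right_cancel hax
        rw [hax] at hψ
        have ht' := hfree (smul_right_injective L (ha y).ne' hψ)
        rw [← ht x, ← ht y, ht', ho]

end Rep

/-! ### The weak indexing systems at the vertices -/

section Values

variable {p : ℕ} [Fact p.Prime] {V : GOrbit (Cp p)}

theorem VSet.iso_iff_count {S T : VSet V} : S.Iso T ↔ S.nfix = T.nfix ∧ S.nfree = T.nfree :=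
  ⟨fun h => ⟨nfix_eq_of_iso h, nfree_eq_of_iso h⟩, fun h => iso_of_count h.1 h.2⟩

theorem VSet.iso_point_iff_of_mem_free (hV : V ∈ Family.free (Cp p)) {S : VSet V} :
    S.Iso (VSet.point V) ↔ S.nfree = 1 := by
  rw [iso_iff_count, nfix_eq_zero hV, nfix_eq_zero hV, nfree_point_of_mem_free hV]
  simp

theorem VSet.iso_point_iff_of_isFixed (hV : V.IsFixed) {S : VSet V} :
    S.Iso (VSet.point V) ↔ S.nfix = 1 ∧ S.nfree = 0 := by
  rw [iso_iff_count, nfix_point_of_isFixed hV, nfree_point_of_isFixed hV]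

theorem VSet.nfix_empty : (VSet.empty V).nfix = 0 :=
  Finite.card_eq_zero_iff.2 ⟨fun x => x.1.elim⟩

theorem VSet.nfree_empty : (VSet.empty V).nfree = 0 := by
  refine nfree_eq_of_natCard ?_
  rw [nfix_empty, mul_zero, zero_add]
  exact Finite.card_eq_zero_iff.2 (inferInstanceAs (IsEmpty Empty))

theorem VSet.iso_empty_iff_count {S : VSet V} :
    S.Iso (VSet.empty V) ↔ S.nfix = 0 ∧ S.nfree = 0 := by
  rw [iso_iff_count, nfix_empty, nfree_empty]

theorem VSet.exists_iso_copies_of_mem_free (hV : V ∈ Family.free (Cp p)) (S : VSet V) :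
    ∃ n, S.Iso (VSet.copies n V) :=
  VSet.iso_copies_iff.2 fun g x h => by rw [hV g _ h, one_smul]

theorem VSet.exists_iso_copies_iff_of_isFixed (hV : V.IsFixed) {S : VSet V} :
    (∃ n, S.Iso (VSet.copies n V)) ↔ S.nfree = 0 := by
  rw [VSet.iso_copies_iff]
  have : (∀ (g : Cp p) (x : S.total), g • S.proj x = S.proj x → g • x = x) ↔
      ∀ x, x ∈ fixedPoints (Cp p) S.total :=
    ⟨fun h x g => h g x (hV g _), fun h g x _ => h x g⟩
  rw [this]
  refine ⟨fun h => nfree_eq_of_natCard ?_, fun h x => ?_⟩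
  · rw [mul_zero, add_zero]
    exact (Nat.card_congr (Equiv.subtypeUnivEquiv h)).symm
  · have hc := S.natCard_total
    rw [h, mul_zero, add_zero] at hc
    have hu : fixedPoints (Cp p) S.total = Set.univ :=
      Set.eq_of_subset_of_ncard_le (Set.subset_univ _) (by rw [Set.ncard_univ]; exact hc.le)
    exact hu ▸ Set.mem_univ x

namespace WIndSys

/-- The join always contains the union of counts; if that union is already admissible, `ofCounts` is
an upper bound realizing it. -/
theorem val_sup {I J : GWIndSys (Cp p)} {A : ℕ → Prop} {B : ℕ → ℕ → Prop}
    (h : Admissible p A B) (hA : ∀ n, A n ↔ I.FreeVal n ∨ J.FreeVal n)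
    (hB : ∀ m k, B m k ↔ I.FixedVal m k ∨ J.FixedVal m k) :
    (∀ n, (I ⊔ J).FreeVal n ↔ A n) ∧ ∀ m k, (I ⊔ J).FixedVal m k ↔ B m k := by
  have hI := le_iff_val.1 (le_sup_left : I ≤ I ⊔ J)
  have hJ := le_iff_val.1 (le_sup_right : J ≤ I ⊔ J)
  have hle : I ⊔ J ≤ ofCounts h := by
    refine sup_le ?_ ?_ <;> rw [le_iff_val] <;>
      simp only [freeVal_ofCounts, fixedVal_ofCounts, hA, hB]
    · exact ⟨fun _ => Or.inl, fun _ _ => Or.inl⟩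
    · exact ⟨fun _ => Or.inr, fun _ _ => Or.inr⟩
  rw [le_iff_val] at hle
  simp only [freeVal_ofCounts, fixedVal_ofCounts] at hle
  exact ⟨fun n => ⟨hle.1 n, fun hn => ((hA n).1 hn).elim (hI.1 n) (hJ.1 n)⟩,
    fun m k => ⟨hle.2 m k, fun hm => ((hB m k).1 hm).elim (hI.2 m k) (hJ.2 m k)⟩⟩

theorem fixedVal_extend (I : WIndSys (Family.free (Cp p))) (m k : ℕ) :
    I.extend.FixedVal m k ↔ False :=
  fixedVal_iff I.extend (B := fun _ _ => False)
    (fun _ hV _ => iff_false_intro fun h => hV.not_mem_free h.1) m k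

theorem freeVal_extend (I : WIndSys (Family.free (Cp p))) {A : ℕ → Prop}
    (h : ∀ V (hV : V ∈ Family.free (Cp p)) (S : VSet V), S ∈ I.sets V hV ↔ A S.nfree) (n : ℕ) :
    I.extend.FreeVal n ↔ A n :=
  freeVal_iff I.extend (fun V hV S => ⟨fun hS => (h V hV S).1 hS.2, fun hS => ⟨hV, (h V hV S).2 hS⟩⟩) n

theorem mem_triv_iff {F : Family (Cp p)} {V : GOrbit (Cp p)} (hVF : V ∈ F)
    (hV : V ∈ Family.free (Cp p)) (S : VSet V) :
    S ∈ (triv F).sets V hVF ↔ S.nfree = 1 :=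
  VSet.iso_point_iff_of_mem_free hV

theorem mem_zero_iff {F : Family (Cp p)} {V : GOrbit (Cp p)} (hVF : V ∈ F)
    (hV : V ∈ Family.free (Cp p)) (S : VSet V) :
    S ∈ (zero F).sets V hVF ↔ S.nfree ≤ 1 := by
  refine (or_congr VSet.iso_empty_iff_count (VSet.iso_point_iff_of_mem_free hV)).trans ?_
  rw [VSet.nfix_eq_zero hV]
  lia

theorem val_triv : (∀ n, (triv (Family.all (Cp p))).FreeVal n ↔ n = 1) ∧
    ∀ m k, (triv (Family.all (Cp p))).FixedVal m k ↔ m = 1 ∧ k = 0 :=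
  ⟨freeVal_iff _ fun _ hV S => mem_triv_iff _ hV S,
    fixedVal_iff (triv (Family.all (Cp p))) (B := fun m k => m = 1 ∧ k = 0)
      fun _ hV _ => VSet.iso_point_iff_of_isFixed hV⟩

theorem val_zero : (∀ n, (zero (Family.all (Cp p))).FreeVal n ↔ n ≤ 1) ∧
    ∀ m k, (zero (Family.all (Cp p))).FixedVal m k ↔ m ≤ 1 ∧ k = 0 := by
  refine ⟨freeVal_iff _ (A := fun n => n ≤ 1) fun _ hV S => mem_zero_iff _ hV S,
    fixedVal_iff _ (B := fun m k => m ≤ 1 ∧ k = 0) fun _ hV _ => ?_⟩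
  refine (or_congr VSet.iso_empty_iff_count (VSet.iso_point_iff_of_isFixed hV)).trans ?_
  lia

theorem val_infty : (∀ n, (infty (Family.all (Cp p))).FreeVal n) ∧
    ∀ m k, (infty (Family.all (Cp p))).FixedVal m k ↔ k = 0 :=
  ⟨fun _ _ hV S _ => VSet.exists_iso_copies_of_mem_free hV S,
    fixedVal_iff (infty (Family.all (Cp p))) (B := fun _ k => k = 0)
      fun _ hV _ => VSet.exists_iso_copies_iff_of_isFixed hV⟩

theorem freeVal_extend_triv (n : ℕ) :
    (triv (Family.free (Cp p))).extend.FreeVal n ↔ n = 1 :=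
  freeVal_extend _ (A := fun n => n = 1) (fun _ hV S => mem_triv_iff hV hV S) n

theorem freeVal_extend_zero (n : ℕ) :
    (zero (Family.free (Cp p))).extend.FreeVal n ↔ n ≤ 1 :=
  freeVal_extend _ (A := fun n => n ≤ 1) (fun _ hV S => mem_zero_iff hV hV S) n

theorem freeVal_extend_infty (n : ℕ) : (infty (Family.free (Cp p))).extend.FreeVal n :=
  fun _ hV S _ => ⟨hV, VSet.exists_iso_copies_of_mem_free hV S⟩

theorem count_ofMap {U W : GOrbit (Cp p)} (f : U →[Cp p] W) (hW : W.IsFixed) :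
    ((VSet.ofMap f).nfix = 1 ∧ (VSet.ofMap f).nfree = 0) ∨
      ((VSet.ofMap f).nfix = 0 ∧ (VSet.ofMap f).nfree = 1) := by
  rcases GOrbit.isFixed_or_mem_free U with hU | hU
  · exact Or.inl ((VSet.iso_point_iff_of_isFixed hW).1
      (VSet.iso_point_iff.2 (GOrbit.hom_bijective_of_isFixed hU f)))
  · have h0 : (VSet.ofMap f).nfix = 0 := VSet.nfix_eq_zero hU (VSet.point U)
    refine Or.inr ⟨h0, VSet.nfree_eq_of_natCard ?_⟩
    rw [h0, zero_add, mul_one]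
    exact GOrbit.natCard_eq_of_mem_free hU

/-- From above: over `C_p/C_p` the generators have counts `(1,0)` or `(0,1)`, all inside an
admissible table. From below: the transfer `C_p/e → C_p/C_p` contributes `(0,1)`, whose restriction
fills the free value, after which every `(0,k)` follows. -/
theorem val_overline : (∀ n, (TransferSystem.complete (Cp p)).toWIndSys.FreeVal n) ∧
    ∀ m k, (TransferSystem.complete (Cp p)).toWIndSys.FixedVal m k ↔
      (m = 1 ∧ k = 0) ∨ m = 0 := by
  set I := (TransferSystem.complete (Cp p)).toWIndSys with hI
  have hle : I ≤ ofCounts admissible_overline := by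
    refine sup_le (le_iff_val.2 ?_) (sInf_le fun V _ S hS => ?_)
    · simp only [freeVal_ofCounts, fixedVal_ofCounts, val_zero.2]
      refine ⟨fun _ _ => trivial, fun m k h => ?_⟩
      change (m = 1 ∧ k = 0) ∨ m = 0
      lia
    · obtain ⟨U, W, f, h, -, rfl⟩ := hS
      refine ⟨fun _ => trivial, fun hV => ?_⟩
      -- A restriction landing on a fixed orbit is along an isomorphism, so it preserves the counts
      -- of the generator.
      have hb := GOrbit.hom_bijective_of_isFixed hV h
      have hW : W.IsFixed := fun g w => by
        obtain ⟨v, rfl⟩ := hb.2 w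
        rw [← map_smul, hV]
      obtain ⟨h1, h2⟩ := VSet.count_res_of_bijective h hb (VSet.ofMap f)
      rw [h1, h2]
      exact (count_ofMap f hW).imp id And.left
  rw [le_iff_val] at hle
  simp only [freeVal_ofCounts, fixedVal_ofCounts] at hle
  have hz : ∀ m k, m ≤ 1 ∧ k = 0 → I.FixedVal m k := fun m k h =>
    (le_iff_val.1 (le_sup_left : _ ≤ I)).2 m k ((val_zero.2 m k).2 h)
  have h00 : I.FixedVal 0 0 := hz 0 0 (by simp)
  have h01 : I.FixedVal 0 1 := by
    have hpt : (GOrbit.pt (Cp p)).IsFixed := GOrbit.isFixed_pt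
    obtain ⟨f⟩ := GOrbit.exists_hom_of_isFixed (GOrbit.regular (Cp p)) hpt
    have hmem : (VSet.ofMap f).res (MulActionHom.id (Cp p)) ∈ I.sets (GOrbit.pt (Cp p)) trivial :=
      (le_sup_right : _ ≤ I) _ _ fun J hJ => hJ _ _ ⟨_, _, f, _, trivial, rfl⟩
    rw [I.mem_iff_fixedVal (hV := trivial) hpt] at hmem
    obtain ⟨h1, h2⟩ := VSet.count_res_of_bijective (MulActionHom.id (Cp p))
      Function.bijective_id (VSet.ofMap f)
    have h0 : (VSet.ofMap f).nfix = 0 :=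
      VSet.nfix_eq_zero GOrbit.regular_mem_free (VSet.point (GOrbit.regular (Cp p)))
    rcases count_ofMap f hpt with h | h
    · rw [h0] at h
      exact absurd h.1 (by simp)
    · rwa [h1, h2, h.1, h.2] at hmem
  have hadm := I.admissible_val
  have hA : ∀ n, I.FreeVal n := hadm.free_all (by simpa using hadm.res h00)
    (Fact.out : p.Prime).two_le (by simpa using hadm.res h01)
  refine ⟨hA, fun m k => ⟨hle.2 m k, ?_⟩⟩
  rintro (⟨rfl, rfl⟩ | rfl)
  · exact hz 1 0 (by simp)
  · exact hadm.fixed_free_all hA h01 k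

theorem val_vertex {L : Type*} [NormedAddCommGroup L] [InnerProductSpace ℝ L]
    {ρ : Representation ℝ (Cp p) L} (horth : ∀ g v, ‖ρ g v‖ = ‖v‖) (hirr : ρ.IsIrreducible)
    (hnontriv : ∃ g v, ρ g v ≠ v) (x : Vertex) :
    (∀ n, (x.system ρ).FreeVal n ↔ x.freeTable n) ∧
      ∀ m k, (x.system ρ).FixedVal m k ↔ x.fixedTable m k := by
  cases x with
  | empty => exact ⟨freeVal_iff _ fun _ _ _ => Iff.rfl, fixedVal_iff _ fun _ _ _ => Iff.rfl⟩
  | extTriv => exact ⟨freeVal_extend_triv, fixedVal_extend _⟩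
  | extZero => exact ⟨freeVal_extend_zero, fixedVal_extend _⟩
  | extInfty => exact ⟨fun n => iff_true_intro (freeVal_extend_infty n), fixedVal_extend _⟩
  | triv => exact val_triv
  | zeroE =>
    refine val_sup admissible_zeroE (fun n => ?_) fun m k => ?_
    · rw [val_triv.1, freeVal_extend_zero]
      change n ≤ 1 ↔ _
      lia
    · rw [val_triv.2, fixedVal_extend, or_false]
      rfl
  | trivJoinExtInfty =>
    refine val_sup admissible_trivJoinExtInfty
      (fun n => ⟨fun _ => Or.inr (freeVal_extend_infty n), fun _ => trivial⟩) fun m k => ?_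
    rw [val_triv.2, fixedVal_extend, or_false]
    rfl
  | zero => exact val_zero
  | inftyE =>
    refine val_sup admissible_inftyE
      (fun n => ⟨fun _ => Or.inr (freeVal_extend_infty n), fun _ => trivial⟩) fun m k => ?_
    rw [val_zero.2, fixedVal_extend, or_false]
    rfl
  | infty => exact ⟨fun n => iff_true_intro (val_infty.1 n), val_infty.2⟩
  | overline => exact ⟨fun n => iff_true_intro (val_overline.1 n), val_overline.2⟩
  | lam =>
    refine ⟨freeVal_iff _ fun V hV S => ?_, fixedVal_iff _ fun V hV S =>
      mem_ofRep_iff horth hirr hnontriv _ S⟩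
    refine iff_true_intro ((mem_ofRep_iff horth hirr hnontriv _ S).2 ?_)
    rw [VSet.nfix_eq_zero hV]
    exact Nat.zero_le 1
  | complete =>
    exact ⟨freeVal_iff _ fun _ _ _ => Iff.rfl, fixedVal_iff _ fun _ _ _ => Iff.rfl⟩

end WIndSys

end Values

/-! ### Unitality in terms of counts -/

namespace WIndSys

variable {p : ℕ} [Fact p.Prime] {I : GWIndSys (Cp p)}

theorem mem_sum_iff_of_mem_free {V : GOrbit (Cp p)} (hV : V ∈ Family.free (Cp p)) (S T : VSet V) :
    S.sum T ∈ I.sets V trivial ↔ I.FreeVal (S.nfree + T.nfree) := by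
  rw [I.mem_iff_freeVal (hV := trivial) hV, VSet.nfree_sum]

theorem mem_sum_iff_of_isFixed {V : GOrbit (Cp p)} (hV : V.IsFixed) (S T : VSet V) :
    S.sum T ∈ I.sets V trivial ↔ I.FixedVal (S.nfix + T.nfix) (S.nfree + T.nfree) := by
  rw [I.mem_iff_fixedVal (hV := trivial) hV, VSet.nfree_sum, VSet.nfix_sum]

/-- Counts are additive in sums and each of them is realized over `C_p/e` or `C_p/C_p`, so summands
of sets become summands of counts. -/
theorem isAlmostEssentiallyUnital_iff :
    I.IsAlmostEssentiallyUnital ↔ SummandClosed I.FreeVal I.FixedVal := by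
  refine ⟨fun h => ⟨fun {n n'} hn hA => ?_, fun {m k m' k'} hm hB => ?_⟩,
    fun h V _ S T hne hS => ?_⟩
  · have hV := GOrbit.regular_mem_free (G := Cp p)
    obtain ⟨S, -, rfl⟩ := exists_vset_nfix_eq_zero (GOrbit.regular (Cp p)) n
    obtain ⟨T, -, rfl⟩ := exists_vset_nfix_eq_zero (GOrbit.regular (Cp p)) n'
    have := h _ trivial S T (by rwa [VSet.iso_point_iff_of_mem_free hV, VSet.nfree_sum])
      ((mem_sum_iff_of_mem_free hV S T).2 hA)
    rwa [I.mem_iff_freeVal (hV := trivial) hV, I.mem_iff_freeVal (hV := trivial) hV] at this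
  · have hV := GOrbit.isFixed_pt (G := Cp p)
    obtain ⟨S, rfl, rfl⟩ := exists_vset_of_isFixed hV m k
    obtain ⟨T, rfl, rfl⟩ := exists_vset_of_isFixed hV m' k'
    have := h _ trivial S T
      (by rwa [VSet.iso_point_iff_of_isFixed hV, VSet.nfree_sum, VSet.nfix_sum])
      ((mem_sum_iff_of_isFixed hV S T).2 hB)
    rwa [I.mem_iff_fixedVal (hV := trivial) hV, I.mem_iff_fixedVal (hV := trivial) hV] at this
  · rcases GOrbit.isFixed_or_mem_free V with hV | hV
    · rw [VSet.iso_point_iff_of_isFixed hV, VSet.nfree_sum, VSet.nfix_sum] at hne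
      rw [I.mem_iff_fixedVal hV, I.mem_iff_fixedVal hV]
      exact h.fixed hne ((mem_sum_iff_of_isFixed hV S T).1 hS)
    · rw [VSet.iso_point_iff_of_mem_free hV, VSet.nfree_sum] at hne
      rw [I.mem_iff_freeVal hV, I.mem_iff_freeVal hV]
      exact h.free hne ((mem_sum_iff_of_mem_free hV S T).1 hS)

/-- A nonempty value over `C_p/C_p` contains the point, whose restrictions make every other value
nonempty. -/
theorem hasOneColor_iff : I.HasOneColor ↔ I.FixedVal 1 0 := by
  refine ⟨fun h => ?_, fun h V _ => ?_⟩
  · obtain ⟨S, hS⟩ := h (GOrbit.pt (Cp p)) trivial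
    exact I.admissible_val.fixed_one ((I.mem_iff_fixedVal GOrbit.isFixed_pt).1 hS)
  · refine ⟨VSet.point V, ?_⟩
    rcases GOrbit.isFixed_or_mem_free V with hV | hV
    · rwa [I.mem_iff_fixedVal hV, VSet.nfix_point_of_isFixed hV, VSet.nfree_point_of_isFixed hV]
    · rw [I.mem_iff_freeVal hV, VSet.nfree_point_of_mem_free hV]
      exact I.admissible_val.res h

theorem IsUnital.isAlmostEssentiallyUnital (h : I.IsUnital) : I.IsAlmostEssentiallyUnital :=
  fun V hV S T _ hS => h.2 V hV S T hS

/-- The two closure conditions differ only on decompositions of the point, which are `*_V ⊔ ∅_V` up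
to order. The empty set over `C_p/C_p` restricts to the empty set over free orbits, so `(0,0)` is
all that is missing. -/
theorem isUnital_iff : I.IsUnital ↔ I.IsAlmostEssentiallyUnital ∧ I.FixedVal 0 0 := by
  refine ⟨fun h => ⟨h.isAlmostEssentiallyUnital, ?_⟩, fun ⟨h, h0⟩ => ⟨?_, fun V _ S T hS => ?_⟩⟩
  · have hV := GOrbit.isFixed_pt (G := Cp p)
    obtain ⟨S, h1, h2⟩ := exists_vset_of_isFixed hV 0 0
    obtain ⟨T, h1', h2'⟩ := exists_vset_of_isFixed hV 1 0
    have := (h.2 _ trivial S T ((mem_sum_iff_of_isFixed hV S T).2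
      (by rw [h1, h2, h1', h2']; exact hasOneColor_iff.1 h.1))).1
    rwa [I.mem_iff_fixedVal (hV := trivial) hV, h1, h2] at this
  · exact hasOneColor_iff.2 (I.admissible_val.fixed_one h0)
  · by_cases hne : (S.sum T).Iso (VSet.point V)
    · have hadm := I.admissible_val
      have h10 := hadm.fixed_one h0
      have hA0 : I.FreeVal 0 := by simpa using hadm.res h0
      rcases GOrbit.isFixed_or_mem_free V with hV | hV
      · rw [VSet.iso_point_iff_of_isFixed hV, VSet.nfree_sum, VSet.nfix_sum, Nat.add_eq_zero_iff,
          Nat.add_eq_one_iff] at hne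
        rw [I.mem_iff_fixedVal hV, I.mem_iff_fixedVal hV, hne.2.1, hne.2.2]
        rcases hne.1 with ⟨h1, h2⟩ | ⟨h1, h2⟩ <;> rw [h1, h2]
        exacts [⟨h0, h10⟩, ⟨h10, h0⟩]
      · rw [VSet.iso_point_iff_of_mem_free hV, VSet.nfree_sum, Nat.add_eq_one_iff] at hne
        rw [I.mem_iff_freeVal hV, I.mem_iff_freeVal hV]
        rcases hne with ⟨h1, h2⟩ | ⟨h1, h2⟩ <;> rw [h1, h2]
        exacts [⟨hA0, hadm.free_one hA0⟩, ⟨hadm.free_one hA0, hA0⟩]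
    · exact h V trivial S T hne hS

/-- `(2,0)` is the sum of two points, and it indexes all binary coproducts over `C_p/C_p`.
Restricted to a free orbit, it and the empty set force the free value to be everything. -/
theorem isIndexingSystem_iff : I.IsIndexingSystem ↔ I.FixedVal 0 0 ∧ I.FixedVal 2 0 := by
  have hpt := GOrbit.isFixed_pt (G := Cp p)
  constructor
  · intro h
    have h0 := (h (GOrbit.pt (Cp p)) trivial).1
    rw [I.mem_iff_fixedVal (hV := trivial) hpt, VSet.nfix_empty, VSet.nfree_empty] at h0
    refine ⟨h0, ?_⟩
    have h1 := (I.mem_iff_fixedVal (hV := trivial) (S := VSet.point _) hpt).2 (by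
      rw [VSet.nfix_point_of_isFixed hpt, VSet.nfree_point_of_isFixed hpt]
      exact I.admissible_val.fixed_one h0)
    have := (h _ trivial).2 _ _ h1 h1
    rwa [mem_sum_iff_of_isFixed hpt, VSet.nfix_point_of_isFixed hpt,
      VSet.nfree_point_of_isFixed hpt] at this
  · rintro ⟨h0, h2⟩ V -
    have hadm := I.admissible_val
    have hA := hadm.free_all (by simpa using hadm.res h0) le_rfl (by simpa using hadm.res h2)
    rcases GOrbit.isFixed_or_mem_free V with hV | hV
    · refine ⟨?_, fun S T hS hT => ?_⟩
      · rwa [I.mem_iff_fixedVal hV, VSet.nfix_empty, VSet.nfree_empty]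
      · rw [I.mem_iff_fixedVal hV] at hS hT
        rw [mem_sum_iff_of_isFixed hV]
        exact hadm.fixed_add h2 hS hT
    · exact ⟨(I.mem_iff_freeVal hV).2 (hA _), fun S T _ _ => (I.mem_iff_freeVal hV).2 (hA _)⟩

theorem IsIndexingSystem.isAlmostEssentiallyUnital (h : I.IsIndexingSystem) :
    I.IsAlmostEssentiallyUnital := by
  rw [isIndexingSystem_iff] at h
  obtain ⟨h0, h2⟩ := h
  have hadm := I.admissible_val
  have hA := hadm.free_all (by simpa using hadm.res h0) le_rfl (by simpa using hadm.res h2)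
  have hc := hadm.fixed_copies_all h2 h0
  rw [isAlmostEssentiallyUnital_iff]
  refine ⟨fun _ _ => ⟨hA _, hA _⟩, fun {m k m' k'} _ hB => ?_⟩
  by_cases hk : k + k' = 0
  · obtain ⟨rfl, rfl⟩ := Nat.add_eq_zero_iff.1 hk
    exact ⟨hc m, hc m'⟩
  · have h01 : I.FixedVal 0 1 := by
      obtain ⟨d, hd⟩ := Nat.exists_eq_succ_of_ne_zero hk
      rw [hd] at hB
      -- A single free orbit is extracted by substituting the point for one free orbit of the given
      -- set and empty sets for everything else.
      simpa using hadm.fixed_sum (ι := Fin (m + m')) (κ := Fin (d + 1)) (fun _ => 0) (fun _ => 0)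
        (Fin.cons 1 fun _ => 0) (by simpa using hB) (fun _ => h0)
        (Fin.cases (hA 1) fun _ => hA 0)
    have hall : ∀ m k, I.FixedVal m k := fun m k => by
      simpa using hadm.fixed_add h2 (hc m) (hadm.fixed_free_all hA h01 k)
    exact ⟨hall m k, hall m' k'⟩

end WIndSys

/-! ### The order on the vertices -/

/-- Enumeration of the vertices, compatible with the arrows. -/
def Vertex.index : Vertex → ℕ
  | empty => 0 | extTriv => 1 | extZero => 2 | extInfty => 3
  | triv => 4 | zeroE => 5 | trivJoinExtInfty => 6
  | zero => 7 | inftyE => 8 | infty => 9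
  | overline => 10 | lam => 11 | complete => 12

theorem Vertex.index_injective : Function.Injective Vertex.index := by
  rintro (_ | _) (_ | _) h <;> first | rfl | simp [Vertex.index] at h

instance : DecidableEq Vertex := fun x y =>
  decidable_of_iff (x.index = y.index) Vertex.index_injective.eq_iff

instance : Fintype Vertex where
  elems := {.empty, .extTriv, .extZero, .extInfty, .triv, .zeroE, .trivJoinExtInfty, .zero,
    .inftyE, .infty, .overline, .lam, .complete}
  complete := by rintro (_ | _) <;> decide

theorem Vertex.card : Fintype.card Vertex = 13 := rfl

/-- The targets of the arrows out of a vertex. -/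
def Vertex.targets : Vertex → List Vertex
  | empty => [extTriv]
  | extTriv => [extZero, triv]
  | extZero => [extInfty, zeroE]
  | extInfty => [trivJoinExtInfty]
  | triv => [zeroE]
  | zeroE => [trivJoinExtInfty, zero]
  | trivJoinExtInfty => [inftyE]
  | zero => [inftyE]
  | inftyE => [infty, overline]
  | infty => [complete]
  | overline => [lam]
  | lam => [complete]
  | complete => []

theorem arrow_iff_mem_targets {x y : Vertex} : Arrow x y ↔ y ∈ x.targets := by
  constructor
  · rintro (_ | _) <;> simp [Vertex.targets]
  · cases x <;> simp only [Vertex.targets, List.mem_cons, List.not_mem_nil, or_false] <;>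
      rintro (rfl | rfl) <;> constructor

instance : DecidableRel Arrow := fun _ _ => decidable_of_iff _ arrow_iff_mem_targets.symm

instance (x : Vertex) (n : ℕ) : Decidable (x.freeTable n) := by
  cases x <;> (unfold Vertex.freeTable; infer_instance)

instance (x : Vertex) (m k : ℕ) : Decidable (x.fixedTable m k) := by
  cases x <;> (unfold Vertex.fixedTable; infer_instance)

/-- Inclusion of the counts at two vertices, tested on sufficiently many counts. -/
def Vertex.Below (x y : Vertex) : Prop :=
  (∀ n ∈ [0, 1, 2], x.freeTable n → y.freeTable n) ∧
    ∀ q ∈ [(1, 0), (0, 0), (2, 0), (0, 1), (1, 1)],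
      x.fixedTable q.1 q.2 → y.fixedTable q.1 q.2

instance : DecidableRel Vertex.Below := fun x y => by
  unfold Vertex.Below
  infer_instance

theorem Arrow.index_lt {x y : Vertex} (h : Arrow x y) : x.index < y.index := by
  cases h <;> decide

theorem Arrow.table_le {x y : Vertex} (h : Arrow x y) :
    (∀ n, x.freeTable n → y.freeTable n) ∧ ∀ m k, x.fixedTable m k → y.fixedTable m k := by
  cases h <;> constructor <;> intros <;> simp only [Vertex.freeTable, Vertex.fixedTable] at * <;> lia

theorem Vertex.table_le_of_reflTransGen {x y : Vertex} (h : Relation.ReflTransGen Arrow x y) :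
    (∀ n, x.freeTable n → y.freeTable n) ∧ ∀ m k, x.fixedTable m k → y.fixedTable m k := by
  induction h with
  | refl => exact ⟨fun _ => id, fun _ _ => id⟩
  | tail _ hz ih =>
    exact ⟨fun n hn => hz.table_le.1 n (ih.1 n hn),
      fun m k hm => hz.table_le.2 m k (ih.2 m k hm)⟩

/-- A finite check; it supplies the first arrow of a chain from `x` to `y`. -/
theorem Vertex.Below.exists_arrow : ∀ {x y : Vertex}, x.Below y → x = y ∨
    ∃ z, Arrow x z ∧ z.Below y := by
  decide +kernel

theorem Vertex.Below.reflTransGen {x y : Vertex} (h : x.Below y) :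
    Relation.ReflTransGen Arrow x y := by
  -- Arrows raise the index, whose maximum is `12`, so this measure drops along the chain.
  induction hn : 12 - x.index using Nat.strong_induction_on generalizing x with
  | _ n ih =>
    rcases h.exists_arrow with rfl | ⟨z, hz, hzy⟩
    · exact .refl
    · have h1 := hz.index_lt
      have h2 : z.index ≤ 12 := by cases z <;> decide
      exact .head hz (ih _ (by lia) hzy rfl)

/-- The left side spells out the covering relation of the order `Below`, in a form decidable over
the 13 vertices. -/
theorem Vertex.arrow_iff_below : ∀ x y : Vertex, ((x.Below y ∧ ¬ y.Below x) ∧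
    ∀ z : Vertex, (x.Below z ∧ ¬ z.Below x) → ¬ (z.Below y ∧ ¬ y.Below z)) ↔ Arrow x y := by
  decide +kernel

/-- Inclusion gives inclusion on the tested counts, this yields a chain of arrows, and each arrow is
an inclusion of all counts. Hence the few tested counts decide the order. -/
theorem Vertex.tfae_le {p : ℕ} [Fact p.Prime] {L : Type*} [NormedAddCommGroup L]
    [InnerProductSpace ℝ L] {ρ : Representation ℝ (Cp p) L} (horth : ∀ g v, ‖ρ g v‖ = ‖v‖)
    (hirr : ρ.IsIrreducible) (hnontriv : ∃ g v, ρ g v ≠ v) (x y : Vertex) :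
    [x.system ρ ≤ y.system ρ, x.Below y, Relation.ReflTransGen Arrow x y].TFAE := by
  have hx := WIndSys.val_vertex horth hirr hnontriv x
  have hy := WIndSys.val_vertex horth hirr hnontriv y
  rw [WIndSys.le_iff_val]
  simp only [hx.1, hx.2, hy.1, hy.2]
  tfae_have 1 → 2 := fun h => ⟨fun n _ => h.1 n, fun q _ => h.2 q.1 q.2⟩
  tfae_have 2 → 3 := Vertex.Below.reflTransGen
  tfae_have 3 → 1 := Vertex.table_le_of_reflTransGen
  tfae_finish

/-- The tested counts separate the vertices, so the 13 systems are pairwise distinct. -/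
theorem Vertex.Below.antisymm : ∀ {x y : Vertex}, x.Below y → y.Below x → x = y := by
  decide +kernel

theorem Vertex.summandClosed (x : Vertex) : SummandClosed x.freeTable x.fixedTable := by
  cases x <;> constructor <;> intros <;>
    simp only [Vertex.freeTable, Vertex.fixedTable] at * <;> lia

end WeakIndexing

/-! ### The classification theorem -/

theorem mainTheorem5 (p : ℕ) [Fact p.Prime] {L : Type*} [NormedAddCommGroup L]
    [InnerProductSpace ℝ L] (lam : Representation ℝ (Cp p) L)
    (horth : ∀ g v, ‖lam g v‖ = ‖v‖) (hirr : lam.IsIrreducible) (hnontriv : ∃ g v, lam g v ≠ v) :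
    (∃ e : Vertex ≃ {I : GWIndSys (Cp p) // I.IsAlmostEssentiallyUnital},
      (∀ x, (e x).1 = x.system lam) ∧
      (∀ x y, e x ≤ e y ↔ Relation.ReflTransGen Arrow x y) ∧
      (∀ x y, e x ⋖ e y ↔ Arrow x y)) ∧
    Nat.card {I : GWIndSys (Cp p) // I.IsAlmostEssentiallyUnital} = 13 ∧
    (∀ I : GWIndSys (Cp p), I.IsIndexingSystem ↔
      ∃ x ∈ ({.infty, .complete} : Set Vertex), I = x.system lam) ∧
    (∀ I : GWIndSys (Cp p), I.IsUnital ∧ ¬ I.IsIndexingSystem ↔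
      ∃ x ∈ ({.zero, .inftyE, .overline, .lam} : Set Vertex), I = x.system lam) ∧
    (∀ I : GWIndSys (Cp p), I.IsAlmostUnital ∧ ¬ I.IsUnital ↔
      ∃ x ∈ ({.triv, .zeroE, .trivJoinExtInfty} : Set Vertex), I = x.system lam) := by
  have hval := WIndSys.val_vertex horth hirr hnontriv
  have hle := Vertex.tfae_le horth hirr hnontriv
  have haeu : ∀ x : Vertex, (x.system lam).IsAlmostEssentiallyUnital := fun x => by
    rw [WIndSys.isAlmostEssentiallyUnital_iff, funext fun n => propext ((hval x).1 n),
      funext fun m => funext fun k => propext ((hval x).2 m k)]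
    exact x.summandClosed
  have hex : ∀ I : GWIndSys (Cp p), I.IsAlmostEssentiallyUnital →
      ∃ x : Vertex, x.system lam = I := fun I hI => by
    obtain ⟨x, h1, h2⟩ := I.admissible_val.exists_vertex (Fact.out : p.Prime).two_le
      (WIndSys.isAlmostEssentiallyUnital_iff.1 hI)
    exact ⟨x, WIndSys.eq_iff_val.2 ⟨fun n => ((hval x).1 n).trans (h1 n).symm,
      fun m k => ((hval x).2 m k).trans (h2 m k).symm⟩⟩
  let e : Vertex ≃ {I : GWIndSys (Cp p) // I.IsAlmostEssentiallyUnital} :=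
    Equiv.ofBijective (fun x => ⟨x.system lam, haeu x⟩)
      ⟨fun x y h => by
        have h : x.system lam = y.system lam := congrArg Subtype.val h
        exact Vertex.Below.antisymm (((hle x y).out 0 1).1 h.le) (((hle y x).out 0 1).1 h.ge),
      fun I => by
        obtain ⟨x, hx⟩ := hex I.1 I.2
        exact ⟨x, Subtype.ext hx⟩⟩
  have hbelow : ∀ x y, e x ≤ e y ↔ x.Below y := fun x y => (hle x y).out 0 1
  -- A property implying almost essential unitality need only be tested on the 13 vertices.
  have key : ∀ (P : GWIndSys (Cp p) → Prop) (Q : Vertex → Prop),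
      (∀ I, P I → I.IsAlmostEssentiallyUnital) → (∀ x, P (Vertex.system lam x) ↔ Q x) →
      ∀ I, P I ↔ ∃ x, Q x ∧ I = x.system lam := fun P Q hP hQ I => by
    constructor
    · intro h
      obtain ⟨x, rfl⟩ := hex I (hP I h)
      exact ⟨x, (hQ x).1 h, rfl⟩
    · rintro ⟨x, hx, rfl⟩
      exact (hQ x).2 hx
  refine ⟨⟨e, fun _ => rfl, fun x y => (hle x y).out 0 2, fun x y => ?_⟩, ?_, ?_, ?_, ?_⟩
  · rw [← Vertex.arrow_iff_below, CovBy, ← e.forall_congr_right]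
    simp only [lt_iff_le_not_ge, hbelow]
  · rw [← Nat.card_congr e, Nat.card_eq_fintype_card, Vertex.card]
  · refine key _ _ (fun I hI => hI.isAlmostEssentiallyUnital) fun x => ?_
    rw [WIndSys.isIndexingSystem_iff, (hval x).2, (hval x).2]
    cases x <;> simp [Vertex.fixedTable]
  · refine key _ _ (fun I hI => hI.1.isAlmostEssentiallyUnital) fun x => ?_
    rw [WIndSys.isUnital_iff, WIndSys.isIndexingSystem_iff, (hval x).2, (hval x).2,
      iff_true_intro (haeu x)]
    cases x <;> simp [Vertex.fixedTable]
  · refine key _ _ (fun I hI => hI.1.1) fun x => ?_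
    rw [WIndSys.IsAlmostUnital, WIndSys.isUnital_iff, WIndSys.hasOneColor_iff, (hval x).2,
      (hval x).2, iff_true_intro (haeu x)]
    cases x <;> simp [Vertex.fixedTable]
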